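/- Let $\mathcal M$ be a von Neumann algebra on a complex Hilbert space $H$ and let $a$ be a positive selfadjoint, possibly unbounded, operator affiliated with the center $\mathfrak C(\mathcal M)=\mathcal M\cap\mathcal M'$ (neither $a$ nor $a^{-1}$ has to be bounded). Let $p_0$ and $p_\infty$ be the spectral projections of $a$ for $[0,1]$ and $(1,\infty)$, and let $a_0=ap_0$, $a_\infty=ap_\infty$. **Spaces of forms.** For $b,c\in\{a_0^\alpha,a_\infty^\alpha : \alpha>0\}$ let $\mathcal S_{b,c}(\mathcal M)$ be the space of all sesquilinear forms $\widehat{bxc}(f,g)=\langle xcf,bg\rangle$, $x\in\mathcal M$, normed by $\|y\|_{b,c}=\inf\{\|x\| : x\in\mathcal M,\ \widehat{bxc}=y\}$. All forms are restricted to the common domain $\bigcap_{\alpha>0}D(a_0^\alpha)\cap D(a_\infty^\alpha)$, which is a core of all these operators. For $b\in\{a_0,a_\infty\}$ let $L_\infty(b^\alpha)=\mathcal S_{b^{\alpha/2},b^{\alpha/2}}(\mathcal M)$. Inclusions between spaces of forms are identities on forms. **Limits.** An intersection of spaces of forms carries the weakest topology for which its inclusions into these spaces are continuous; the union of an increasing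 family of them carries the strongest locally convex topology for which the inclusions of these spaces into it are continuous. With these topologies let $$\mathfrak L_\infty(a_0)=\bigcap_{\alpha>1}L_\infty(a_0^\alpha),\qquad \mathfrak L_\infty(a_\infty)=\bigcup_{\alpha>1}L_\infty(a_\infty^\alpha),$$ $$\underline{\mathfrak L_{0,\infty}}=\bigcup_{\beta>0}\bigcap_{\alpha>0}\mathcal S_{a_0^\alpha,a_\infty^\beta}(\mathcal M),\qquad \overline{\mathfrak L_{0,\infty}}=\bigcap_{\alpha>0}\bigcup_{\beta>0}\mathcal S_{a_0^\alpha,a_\infty^\beta}(\mathcal M),$$ $$\underline{\mathfrak L_{\infty,0}}=\bigcup_{\beta>0}\bigcap_{\alpha>0}\mathcal S_{a_\infty^\beta,a_0^\alpha}(\mathcal M),\qquad \overline{\mathfrak L_{\infty,0}}=\bigcap_{\alpha>0}\bigcup_{\beta>0}\mathcal S_{a_\infty^\beta,a_0^\alpha}(\mathcal M).$$ The lower and the upper limit of the spaces $L_\infty(a^\alpha)$ are the spaces of forms $$\underline{\lim}\,L_\infty(a^\alpha)=\begin{pmatrix}\mathfrak L_\infty(a_0)&\underline{\mathfrak L_{0,\infty}}\\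 \underline{\mathfrak L_{\infty,0}}&\mathfrak L_\infty(a_\infty)\end{pmatrix},\qquad \overline{\lim}\,L_\infty(a^\alpha)=\begin{pmatrix}\mathfrak L_\infty(a_0)&\overline{\mathfrak L_{0,\infty}}\\ \overline{\mathfrak L_{\infty,0}}&\mathfrak L_\infty(a_\infty)\end{pmatrix},$$ where a matrix stands for the space of sums of forms from its four entries, with the direct sum topology. **Statement.** One has $\underline{\mathfrak L_{0,\infty}}=\overline{\mathfrak L_{0,\infty}}$ and $\underline{\mathfrak L_{\infty,0}}=\overline{\mathfrak L_{\infty,0}}$, and hence $\underline{\lim}\,L_\infty(a^\alpha)=\overline{\lim}\,L_\infty(a^\alpha)$, each time as vector spaces and as topological spaces. So the limit space $\mathfrak L_\infty(a)=\lim_\alpha L_\infty(a^\alpha)$ is well defined. It is an (LF)-space: it is Hausdorff and is the locally convex inductive limit of an increasing sequence of Fréchet spaces with continuous inclusions. -/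

import Mathlib

open scoped Topology

noncomputable section

namespace PowerLimit

/-! ### Subspaces carrying their own topology, and limits of families of them -/

/-- A linear subspace of `V` together with a topology of its own
(not necessarily the one induced from anything on `V`). -/
structure TopSubspace (V : Type*) [AddCommGroup V] [Module ℂ V] where
  /-- the underlying linear subspace -/
  carrier : Submodule ℂ V
  /-- its topology -/
  top : TopologicalSpace carrier

section Limits

variable {V : Type*} [AddCommGroup V] [Module ℂ V] {ι : Type*}

/-- The topology of a (semi)norm `N`: a set is open iff it contains, with each of its points,
a ball of positive radius around this point. -/
@[reducible]
def normTopology {E : Type*} [AddCommGroup E] (N : E → ℝ) : TopologicalSpace E where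
  IsOpen U := ∀ y ∈ U, ∃ ε : ℝ, 0 < ε ∧ ∀ z, N (z - y) < ε → z ∈ U
  isOpen_univ := fun _ _ => ⟨1, one_pos, fun _ _ => Set.mem_univ _⟩
  isOpen_inter := by
    rintro U W hU hW y ⟨hyU, hyW⟩
    obtain ⟨ε, hε, h1⟩ := hU y hyU
    obtain ⟨δ, hδ, h2⟩ := hW y hyW
    exact ⟨min ε δ, lt_min hε hδ, fun z hz =>
      ⟨h1 z (hz.trans_le (min_le_left _ _)), h2 z (hz.trans_le (min_le_right _ _))⟩⟩
  isOpen_sUnion := by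
    rintro S hS y ⟨U, hU, hy⟩
    obtain ⟨ε, hε, h⟩ := hS U hU y hy
    exact ⟨ε, hε, fun z hz => ⟨U, hU, h z hz⟩⟩

/-- Projective limit (intersection): the intersection of the spaces `E i` with the weakest
topology for which all inclusions into the `E i` are continuous. -/
def projLim (E : ι → TopSubspace V) : TopSubspace V where
  carrier := ⨅ i, (E i).carrier
  top := ⨅ i, TopologicalSpace.induced (Submodule.inclusion (iInf_le _ i)) (E i).top

/-- Locally convex inductive limit: the linear span of the union of the spaces `E i` (which is the
union itself when the family is directed) with the strongest locally convex vector space topology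
for which all inclusions of the `E i` are continuous. -/
def indLim (E : ι → TopSubspace V) : TopSubspace V where
  carrier := ⨆ i, (E i).carrier
  top := sInf {t | @IsTopologicalAddGroup _ t _ ∧ @ContinuousSMul ℂ _ _ _ t ∧
    @LocallyConvexSpace ℝ _ _ _ _ _ t ∧
    ∀ i, @Continuous _ _ (E i).top t
      (Submodule.inclusion (le_iSup (fun j => (E j).carrier) i))}

/-- The sum map of four subspaces of `V`. -/
def sumMap (A B C D : TopSubspace V) :
    (A.carrier × B.carrier) × (C.carrier × D.carrier) →ₗ[ℂ] V :=
  ((A.carrier.subtype.coprod B.carrier.subtype).coprod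
    (C.carrier.subtype.coprod D.carrier.subtype))

/-- The space of all `y₁₁ + y₁₂ + y₂₁ + y₂₂` with entries in the spaces `A`, `B`, `C`, `D` of the
matrix `(A B; C D)`, with the direct sum topology, i.e. the one carried over from the product
topology of the entries. -/
def matrixSpace (A B C D : TopSubspace V) : TopSubspace V where
  carrier := LinearMap.range (sumMap A B C D)
  top := TopologicalSpace.coinduced (sumMap A B C D).rangeRestrict
    (@instTopologicalSpaceProd _ _
      (@instTopologicalSpaceProd _ _ A.top B.top) (@instTopologicalSpaceProd _ _ C.top D.top))

/-- A Fréchet space: a complete metrizable locally convex space. -/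
structure IsFrechetSpace (E : Type*) [AddCommGroup E] [Module ℂ E] [TopologicalSpace E] :
    Prop where
  isTopologicalAddGroup : IsTopologicalAddGroup E
  continuousSMul : ContinuousSMul ℂ E
  locallyConvexSpace : LocallyConvexSpace ℝ E
  metrizableSpace : TopologicalSpace.MetrizableSpace E
  completeSpace : @CompleteSpace E (IsTopologicalAddGroup.rightUniformSpace E)

/-- An (LF)-space: a Hausdorff locally convex space which is the locally convex inductive limit
of an increasing sequence of Fréchet spaces with continuous inclusions. -/
def IsLFSpace (E : TopSubspace V) : Prop :=
  @T2Space E.carrier E.top ∧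
  ∃ F : ℕ → TopSubspace V,
    (∀ n, @IsFrechetSpace (F n).carrier _ _ (F n).top) ∧
    (∀ n, ∃ h : (F n).carrier ≤ (F (n + 1)).carrier,
      @Continuous _ _ (F n).top (F (n + 1)).top (Submodule.inclusion h)) ∧
    E = indLim F

/-- The upper iterated limit `⋂_α ⋃_β S α β` of a double family. -/
def upperOff (S : Set.Ioi (0 : ℝ) → Set.Ioi (0 : ℝ) → TopSubspace V) : TopSubspace V :=
  projLim fun α : Set.Ioi (0 : ℝ) => indLim fun β : Set.Ioi (0 : ℝ) => S α β

/-- The lower iterated limit `⋃_β ⋂_α S α β` of a double family. -/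
def lowerOff (S : Set.Ioi (0 : ℝ) → Set.Ioi (0 : ℝ) → TopSubspace V) : TopSubspace V :=
  indLim fun β : Set.Ioi (0 : ℝ) => projLim fun α : Set.Ioi (0 : ℝ) => S α β

end Limits

/-! ### Positive operators affiliated with a von Neumann algebra -/

variable {H : Type*} [NormedAddCommGroup H] [InnerProductSpace ℂ H] [CompleteSpace H]

/-- The center `M ∩ M'` of a von Neumann algebra, itself a von Neumann algebra. -/
def center (M : VonNeumannAlgebra H) : VonNeumannAlgebra H where
  toStarSubalgebra := M.toStarSubalgebra ⊓ M.commutant.toStarSubalgebra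
  centralizer_centralizer' := by
    have h : (M.toStarSubalgebra ⊓ M.commutant.toStarSubalgebra).carrier
        = Set.centralizer ((M : Set (H →L[ℂ] H)) ∪ (M.commutant : Set (H →L[ℂ] H))) := by
      rw [Set.centralizer_union, VonNeumannAlgebra.coe_commutant,
        VonNeumannAlgebra.centralizer_centralizer, Set.inter_comm,
        ← VonNeumannAlgebra.coe_commutant]
      rfl
    rw [h, Set.centralizer_centralizer_centralizer]

/-- A (possibly unbounded) operator `a` is affiliated with `N` if it commutes with every unitary
`u` of the commutant of `N`: `u` maps the domain of `a` into itself and `a u = u a` there. -/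
def IsAffiliated (a : H →ₗ.[ℂ] H) (N : VonNeumannAlgebra H) : Prop :=
  ∀ u ∈ unitary (H →L[ℂ] H), u ∈ N.commutant → ∀ f : a.domain,
    ∃ h : u (f : H) ∈ a.domain, a ⟨u (f : H), h⟩ = u (a f)

/-- A positive selfadjoint (possibly unbounded) operator. -/
structure IsPositiveSelfAdjoint (a : H →ₗ.[ℂ] H) : Prop where
  isSelfAdjoint : IsSelfAdjoint a
  nonneg : ∀ f : a.domain, 0 ≤ RCLike.re (inner ℂ (f : H) (a f))

open Classical in
/-- The bounded operator `(1 + a)⁻¹`, which exists and is unique when `a` is positive and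
selfadjoint (junk value `0` if there is none). -/
def resolvent (a : H →ₗ.[ℂ] H) : H →L[ℂ] H :=
  if h : ∃ R : H →L[ℂ] H, ∀ v : H, ∃ hv : R v ∈ a.domain, R v + a ⟨R v, hv⟩ = v
  then h.choose else 0

/-- The power `a ^ α`, `α > 0`, of a positive selfadjoint operator. With `R = (1 + a)⁻¹` one has
`t ^ α * (1 / (1 + t)) ^ α = (1 - 1 / (1 + t)) ^ α`, so that `a ^ α` has the domain `ran (R ^ α)`
and maps `R ^ α h` to `(1 - R) ^ α h`; that is, its graph is `{(R ^ α h, (1 - R) ^ α h)}`. The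
powers of the bounded positive operators `R` and `1 - R` are those of the continuous functional
calculus. -/
def opPow (a : H →ₗ.[ℂ] H) (α : ℝ) : H →ₗ.[ℂ] H :=
  (LinearMap.range
    (((resolvent a ^ α : H →L[ℂ] H) : H →ₗ[ℂ] H).prod
      (((1 - resolvent a) ^ α : H →L[ℂ] H) : H →ₗ[ℂ] H))).toLinearPMap

/-- The bounded operator `max (1 / 2 - (1 + a)⁻¹) 0`. As a function of `t ∈ [0, ∞)` it vanishes
exactly on `[0, 1]`, so that its kernel is the spectral subspace of `a` for `[0, 1]`. -/
def cutoff (a : H →ₗ.[ℂ] H) : H →L[ℂ] H :=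
  cfc (fun r : ℝ => max (1 / 2 - r) 0) (resolvent a)

/-- The spectral projection `p₀ = 1_{[0, 1]}(a)`. -/
def projLow (a : H →ₗ.[ℂ] H) : H →L[ℂ] H :=
  (LinearMap.ker (cutoff a : H →ₗ[ℂ] H)).starProjection

/-- The spectral projection `p_∞ = 1_{(1, ∞)}(a)`. -/
def projHigh (a : H →ₗ.[ℂ] H) : H →L[ℂ] H := 1 - projLow a

/-- The product `a p` with its natural domain `{f | p f ∈ D(a)}`. -/
def mulRight (a : H →ₗ.[ℂ] H) (p : H →L[ℂ] H) : H →ₗ.[ℂ] H where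
  domain := a.domain.comap (p : H →ₗ[ℂ] H)
  toFun := a.toFun ∘ₗ (p : H →ₗ[ℂ] H).restrict (fun _ h => h)

/-- The part `a₀ = a p₀` of `a`, with spectrum in `[0, 1]`. -/
def lowPart (a : H →ₗ.[ℂ] H) : H →ₗ.[ℂ] H := mulRight a (projLow a)

/-- The part `a_∞ = a p_∞` of `a`. -/
def highPart (a : H →ₗ.[ℂ] H) : H →ₗ.[ℂ] H := mulRight a (projHigh a)

/-! ### The spaces of sesquilinear forms -/

/-- The common domain `⋂_{α > 0} D(a₀ ^ α) ∩ D(a_∞ ^ α)` of all forms which occur; it is a core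
of all the powers, so that every form below is determined by its restriction to it. -/
def core (a : H →ₗ.[ℂ] H) : Submodule ℂ H :=
  ⨅ α : Set.Ioi (0 : ℝ), (opPow (lowPart a) α).domain ⊓ (opPow (highPart a) α).domain

lemma core_le_low (a : H →ₗ.[ℂ] H) {α : ℝ} (hα : 0 < α) :
    core a ≤ (opPow (lowPart a) α).domain :=
  (iInf_le _ (⟨α, hα⟩ : Set.Ioi (0 : ℝ))).trans inf_le_left

lemma core_le_high (a : H →ₗ.[ℂ] H) {α : ℝ} (hα : 0 < α) :
    core a ≤ (opPow (highPart a) α).domain :=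
  (iInf_le _ (⟨α, hα⟩ : Set.Ioi (0 : ℝ))).trans inf_le_right

/-- Sesquilinear forms on `D`, linear in the first and conjugate linear in the second argument. -/
abbrev Form (D : Submodule ℂ H) : Type _ := D →ₗ[ℂ] D →ₗ⋆[ℂ] ℂ

/-- The form `(f, g) ↦ ⟨x b f, a g⟩`, restricted to `D`, as a linear function of the bounded
operator `x`. (Mathlib's inner product is conjugate linear in its first argument.) -/
def hatForm {D : Submodule ℂ H} (a b : H →ₗ.[ℂ] H) (ha : D ≤ a.domain) (hb : D ≤ b.domain) :
    (H →L[ℂ] H) →ₗ[ℂ] Form D where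
  toFun x := LinearMap.mk₂'ₛₗ (RingHom.id ℂ) (starRingEnd ℂ)
    (fun f g => inner ℂ (a (Submodule.inclusion ha g)) (x (b (Submodule.inclusion hb f))))
    (fun f f' g => by simp [map_add, LinearPMap.map_add])
    (fun c f g => by simp [LinearPMap.map_smul])
    (fun f g g' => by simp [map_add, LinearPMap.map_add])
    (fun c f g => by simp [LinearPMap.map_smul, mul_comm])
  map_add' x y := by
    ext f g
    simp
  map_smul' c x := by
    ext f g
    simp

/-- The space `S_{a,b}(M)` of all forms `(f, g) ↦ ⟨x b f, a g⟩`, `x ∈ M`, with the norm of the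
form of `x` equal to the minimal norm of an element of `M` which induces the same form
(this is `‖x‖` itself when `a` and `b` are injective). -/
def formSpace (M : VonNeumannAlgebra H) {D : Submodule ℂ H} (a b : H →ₗ.[ℂ] H)
    (ha : D ≤ a.domain) (hb : D ≤ b.domain) : TopSubspace (Form D) where
  carrier := (Subalgebra.toSubmodule M.toStarSubalgebra.toSubalgebra).map (hatForm a b ha hb)
  top := normTopology fun y =>
    sInf {r : ℝ | ∃ x : H →L[ℂ] H, x ∈ M ∧ hatForm a b ha hb x = (y : Form D) ∧ ‖x‖ = r}

section Spaces

variable (M : VonNeumannAlgebra H) (a : H →ₗ.[ℂ] H)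

/-- `L_∞(a₀ ^ α)`: the forms `(f, g) ↦ ⟨x a₀ ^ (α / 2) f, a₀ ^ (α / 2) g⟩`. -/
def LinfLow (α : Set.Ioi (1 : ℝ)) : TopSubspace (Form (core a)) :=
  have h : (0 : ℝ) < α / 2 := half_pos (one_pos.trans α.2)
  formSpace M (opPow (lowPart a) (α / 2)) (opPow (lowPart a) (α / 2))
    (core_le_low a h) (core_le_low a h)

/-- `L_∞(a_∞ ^ α)`: the forms `(f, g) ↦ ⟨x a_∞ ^ (α / 2) f, a_∞ ^ (α / 2) g⟩`. -/
def LinfHigh (α : Set.Ioi (1 : ℝ)) : TopSubspace (Form (core a)) :=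
  have h : (0 : ℝ) < α / 2 := half_pos (one_pos.trans α.2)
  formSpace M (opPow (highPart a) (α / 2)) (opPow (highPart a) (α / 2))
    (core_le_high a h) (core_le_high a h)

/-- The diagonal limit `⋂_{α > 1} L_∞(a₀ ^ α)` with its projective topology. -/
def limLow : TopSubspace (Form (core a)) := projLim (LinfLow M a)

/-- The diagonal limit `⋃_{α > 1} L_∞(a_∞ ^ α)` with its inductive topology. -/
def limHigh : TopSubspace (Form (core a)) := indLim (LinfHigh M a)

/-- `S_{a₀ ^ α, a_∞ ^ β}(M)`: the forms `(f, g) ↦ ⟨x a_∞ ^ β f, a₀ ^ α g⟩`. -/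
def offLowHigh (α β : Set.Ioi (0 : ℝ)) : TopSubspace (Form (core a)) :=
  formSpace M (opPow (lowPart a) α) (opPow (highPart a) β)
    (core_le_low a α.2) (core_le_high a β.2)

/-- `S_{a_∞ ^ β, a₀ ^ α}(M)`: the forms `(f, g) ↦ ⟨x a₀ ^ α f, a_∞ ^ β g⟩`. Also here `α` is the
exponent of `a₀` and `β` that of `a_∞`. -/
def offHighLow (α β : Set.Ioi (0 : ℝ)) : TopSubspace (Form (core a)) :=
  formSpace M (opPow (highPart a) β) (opPow (lowPart a) α)
    (core_le_high a β.2) (core_le_low a α.2)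

/-- The lower limit of the spaces `L_∞(a ^ α)`. -/
def lowerLim : TopSubspace (Form (core a)) :=
  matrixSpace (limLow M a) (lowerOff (offLowHigh M a)) (lowerOff (offHighLow M a)) (limHigh M a)

/-- The upper limit of the spaces `L_∞(a ^ α)`. -/
def upperLim : TopSubspace (Form (core a)) :=
  matrixSpace (limLow M a) (upperOff (offLowHigh M a)) (upperOff (offHighLow M a)) (limHigh M a)

end Spaces

end PowerLimit

end

/-! Since `a` is affiliated with the center, its resolvent, and hence the spectral projection
`projLow a` = p₀, lie in the center of `M`. The powers of a₀ take values in ran p₀, those of a_∞ in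
ran (1 - p₀), and every x in `M` preserves both subspaces. So each form ⟨x a_∞^β f, a₀^α g⟩ is zero
(`carrier_offLowHigh`, `carrier_offHighLow`). All off-diagonal spaces vanish, and the lower and
upper limits agree for this reason alone.

What remains is the diagonal. Each space of forms is a Banach quotient of `M`
(`isFrechet_formSpace`). Because a₀ ≤ 1, and a_∞ is at least 1 off its kernel, a larger exponent
shrinks `LinfLow` and enlarges `LinfHigh`, continuously and by multipliers from `M`
(`exists_lowPow_eq`, `exists_highPow_eq`). Integer exponents are cofinal, so the low entry is a
countable projective limit of Banach spaces, thus Fréchet, and the high entry is an inductive limit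
of a sequence of Banach spaces. Compression by p₀ shows that their sum is direct
(`sumMap_limits_injective`). Adding the fixed low entry to each step of the high one gives the
defining sequence of Fréchet spaces (`matrixSpace_indLim`). The limit is Hausdorff because the
evaluations of forms are continuous and separate points.

The unbounded powers are handled through S = (1 + X)⁻¹, where X = (1 - S)/S, so that every estimate
is a statement about the spectrum of a bounded operator. -/

noncomputable section

namespace PowerLimit

/-! ### Limits, Fréchet spaces and direct sums of subspaces with their own topologies -/

section General

attribute [local instance] TopSubspace.top

variable {V : Type*} [AddCommGroup V] [Module ℂ V] {ι : Type*}

/-- `E ≤ F` if `E` is contained in `F` with a continuous inclusion. -/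
instance : LE (TopSubspace V) where
  le E F := ∃ h : E.carrier ≤ F.carrier, Continuous (Submodule.inclusion h)

/-- Antisymmetry reduces an identity of spaces, topology included, to two continuous inclusions,
each supplied by a universal property. -/
instance : PartialOrder (TopSubspace V) where
  le_refl E := ⟨le_rfl, continuous_id⟩
  le_trans E F G := by
    rintro ⟨h₁, c₁⟩ ⟨h₂, c₂⟩
    exact ⟨h₁.trans h₂, c₂.comp c₁⟩
  le_antisymm E F := by
    rintro ⟨h₁, c₁⟩ ⟨h₂, c₂⟩
    obtain ⟨E, s⟩ := E
    obtain ⟨F, t⟩ := F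
    obtain rfl : E = F := le_antisymm h₁ h₂
    congr
    exact le_antisymm (continuous_id_iff_le.1 c₁) (continuous_id_iff_le.1 c₂)

/-- The subspace `E` is a locally convex topological vector space. -/
structure TopSubspace.IsLocallyConvex (E : TopSubspace V) : Prop where
  isTopologicalAddGroup : IsTopologicalAddGroup E.carrier
  continuousSMul : ContinuousSMul ℂ E.carrier
  locallyConvexSpace : LocallyConvexSpace ℝ E.carrier

/-- The subspace `E` is a Fréchet space. -/
def TopSubspace.IsFrechet (E : TopSubspace V) : Prop := IsFrechetSpace E.carrier

lemma TopSubspace.IsFrechet.isLocallyConvex {E : TopSubspace V} (h : E.IsFrechet) :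
    E.IsLocallyConvex :=
  ⟨IsFrechetSpace.isTopologicalAddGroup h, IsFrechetSpace.continuousSMul h,
    IsFrechetSpace.locallyConvexSpace h⟩

/-- The functionals in `Λ` are continuous on `E`. -/
def TopSubspace.ContinuousFunctionals (E : TopSubspace V) (Λ : Set (V →ₗ[ℂ] ℂ)) : Prop :=
  ∀ l ∈ Λ, Continuous fun y : E.carrier => l y

lemma TopSubspace.ContinuousFunctionals.t2Space {E : TopSubspace V} {Λ : Set (V →ₗ[ℂ] ℂ)}
    (h : E.ContinuousFunctionals Λ) (hΛ : ∀ v, (∀ l ∈ Λ, l v = 0) → v = 0) :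
    T2Space E.carrier := by
  let φ : E.carrier → (Λ → ℂ) := fun y l => l.1 y
  have hφ : Continuous φ := continuous_pi fun l => h l.1 l.2
  refine T2Space.of_injective_continuous (f := φ) (fun x y hxy => ?_) hφ
  refine Subtype.ext (sub_eq_zero.1 (hΛ _ fun l hl => ?_))
  rw [map_sub, sub_eq_zero]
  exact congrFun hxy ⟨l, hl⟩

/-! ### Projective limits -/

lemma projLim_le (E : ι → TopSubspace V) (i : ι) : projLim E ≤ E i :=
  ⟨iInf_le _ i, continuous_iff_le_induced.2 (iInf_le _ i)⟩

lemma le_projLim {E : ι → TopSubspace V} {G : TopSubspace V} (h : ∀ i, G ≤ E i) :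
    G ≤ projLim E := by
  refine ⟨le_iInf fun i => (h i).1, ?_⟩
  refine continuous_iInf_rng.2 fun i => continuous_induced_rng.2 ?_
  exact (h i).2

lemma projLim_eq_of_cofinal {κ : Type*} {E : ι → TopSubspace V} (s : κ → ι)
    (h : ∀ i, ∃ k, E (s k) ≤ E i) : projLim E = projLim fun k => E (s k) :=
  le_antisymm (le_projLim fun _ => projLim_le E _) (le_projLim fun i => by
    obtain ⟨k, hk⟩ := h i
    exact (projLim_le (fun k => E (s k)) k).trans hk)

lemma TopSubspace.ContinuousFunctionals.of_le {E F : TopSubspace V} (h : E ≤ F)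
    {Λ : Set (V →ₗ[ℂ] ℂ)} (hF : F.ContinuousFunctionals Λ) : E.ContinuousFunctionals Λ :=
  fun l hl => (hF l hl).comp h.2

/-! ### Inductive limits -/

lemma isLocallyConvex_indLim (E : ι → TopSubspace V) : (indLim E).IsLocallyConvex where
  isTopologicalAddGroup := topologicalAddGroup_sInf fun _ h => h.1
  continuousSMul := continuousSMul_sInf fun _ h => h.2.1
  locallyConvexSpace := LocallyConvexSpace.sInf fun _ h => h.2.2.1

lemma le_indLim (E : ι → TopSubspace V) (i : ι) : E i ≤ indLim E :=
  ⟨le_iSup (fun j => (E j).carrier) i, continuous_sInf_rng.2 fun _ h => h.2.2.2 i⟩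

/-- The topology induced by `T` is itself locally convex and makes all inclusions continuous, so it
is one of those whose infimum defines `indLim`. -/
lemma continuous_indLim {E : ι → TopSubspace V} {Z : Type*} [AddCommGroup Z] [Module ℂ Z]
    [TopologicalSpace Z] [IsTopologicalAddGroup Z] [ContinuousSMul ℂ Z] [LocallyConvexSpace ℝ Z]
    (T : (indLim E).carrier →ₗ[ℂ] Z)
    (h : ∀ i, Continuous (T ∘ Submodule.inclusion (le_indLim E i).1)) :
    Continuous T := by
  refine continuous_iff_le_induced.2 (sInf_le ⟨?_, ?_, ?_, fun i => ?_⟩)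
  · exact topologicalAddGroup_induced T
  · exact continuousSMul_induced T
  · exact LocallyConvexSpace.induced (T.restrictScalars ℝ)
  · exact continuous_induced_rng.2 (h i)

lemma indLim_le {E : ι → TopSubspace V} {G : TopSubspace V} (hG : G.IsLocallyConvex)
    (h : ∀ i, E i ≤ G) : indLim E ≤ G := by
  have := hG.1
  have := hG.2
  have := hG.3
  exact ⟨iSup_le fun i => (h i).1, continuous_indLim
    (Submodule.inclusion (iSup_le fun i => (h i).1)) fun i => (h i).2⟩

lemma indLim_eq_of_cofinal {κ : Type*} {E : ι → TopSubspace V} (s : κ → ι)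
    (h : ∀ i, ∃ k, E i ≤ E (s k)) : indLim E = indLim fun k => E (s k) :=
  le_antisymm (indLim_le (isLocallyConvex_indLim _) fun i => by
    obtain ⟨k, hk⟩ := h i
    exact hk.trans (le_indLim (fun k => E (s k)) k))
    (indLim_le (isLocallyConvex_indLim _) fun _ => le_indLim E _)

lemma continuousFunctionals_indLim {E : ι → TopSubspace V} {Λ : Set (V →ₗ[ℂ] ℂ)}
    (h : ∀ i, (E i).ContinuousFunctionals Λ) : (indLim E).ContinuousFunctionals Λ :=
  fun l hl => continuous_indLim (l ∘ₗ (indLim E).carrier.subtype) fun i => h i l hl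

/-! ### Zero spaces -/

lemma TopSubspace.ext_of_eq_bot {E F : TopSubspace V} (hE : E.carrier = ⊥) (hF : F.carrier = ⊥) :
    E = F := by
  obtain ⟨E, s⟩ := E
  obtain ⟨F, t⟩ := F
  obtain rfl : E = ⊥ := hE
  obtain rfl : F = ⊥ := hF
  congr
  exact Subsingleton.elim _ _

lemma carrier_upperOff_eq_bot {S : Set.Ioi (0 : ℝ) → Set.Ioi (0 : ℝ) → TopSubspace V}
    (h : ∀ α β, (S α β).carrier = ⊥) : (upperOff S).carrier = ⊥ := by
  -- An intersection over an empty index set would be the whole space.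
  have : Nonempty (Set.Ioi (0 : ℝ)) := ⟨⟨1, Set.mem_Ioi.2 one_pos⟩⟩
  simp [upperOff, projLim, indLim, h]

lemma carrier_lowerOff_eq_bot {S : Set.Ioi (0 : ℝ) → Set.Ioi (0 : ℝ) → TopSubspace V}
    (h : ∀ α β, (S α β).carrier = ⊥) : (lowerOff S).carrier = ⊥ := by
  have : Nonempty (Set.Ioi (0 : ℝ)) := ⟨⟨1, Set.mem_Ioi.2 one_pos⟩⟩
  simp [lowerOff, projLim, indLim, h]

/-! ### Fréchet spaces -/

lemma IsFrechetSpace.of_induced {X Y : Type*} [AddCommGroup X] [Module ℂ X] [AddCommGroup Y]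
    [Module ℂ Y] {tX : TopologicalSpace X} [tY : TopologicalSpace Y] (hY : IsFrechetSpace Y)
    (φ : X →ₗ[ℂ] Y) (hφ : Function.Injective φ) (htop : tX = tY.induced φ)
    (hrange : IsClosed (Set.range φ)) : IsFrechetSpace X := by
  subst htop
  obtain ⟨_, _, _, _, hc⟩ := hY
  let : TopologicalSpace X := tY.induced φ
  have hind : Topology.IsInducing φ := ⟨rfl⟩
  have : IsTopologicalAddGroup X := topologicalAddGroup_induced φ
  refine ⟨inferInstance, continuousSMul_induced φ,
    LocallyConvexSpace.induced (φ.restrictScalars ℝ),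
    (⟨hind, hφ⟩ : Topology.IsEmbedding φ).metrizableSpace, ?_⟩
  let uY : UniformSpace Y := IsTopologicalAddGroup.rightUniformSpace Y
  have : IsUniformAddGroup Y := isUniformAddGroup_of_addCommGroup
  let uX : UniformSpace X := IsTopologicalAddGroup.rightUniformSpace X
  have : IsUniformAddGroup X := isUniformAddGroup_of_addCommGroup
  have hu : IsUniformInducing φ :=
    AddMonoidHom.isUniformInducing_of_isInducing (f := φ.toAddMonoidHom) hind
  exact hu.completeSpace hrange.isComplete

lemma IsFrechetSpace.pi {κ : Type*} [Countable κ] {X : κ → Type*} [∀ k, AddCommGroup (X k)]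
    [∀ k, Module ℂ (X k)] [∀ k, TopologicalSpace (X k)] (h : ∀ k, IsFrechetSpace (X k)) :
    IsFrechetSpace (∀ k, X k) := by
  have := fun k => (h k).1
  have := fun k => (h k).2
  have := fun k => (h k).3
  have := fun k => (h k).4
  have hm : TopologicalSpace.MetrizableSpace (∀ k, X k) := by
    -- A countable product is first countable, and a first countable Hausdorff group is metrizable.
    let : UniformSpace (∀ k, X k) := IsTopologicalAddGroup.rightUniformSpace _
    have : IsUniformAddGroup (∀ k, X k) := isUniformAddGroup_of_addCommGroup
    have := IsUniformAddGroup.uniformity_countably_generated (α := ∀ k, X k)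
    exact UniformSpace.metrizableSpace
  refine ⟨inferInstance, inferInstance, inferInstance, hm, ?_⟩
  let u : ∀ k, UniformSpace (X k) := fun k => IsTopologicalAddGroup.rightUniformSpace (X k)
  have : ∀ k, IsUniformAddGroup (X k) := fun k => isUniformAddGroup_of_addCommGroup
  have := fun k => (h k).5
  -- The uniformity of the product group is the product uniformity, for which completeness is known.
  rw [IsUniformAddGroup.rightUniformSpace_eq]
  infer_instance

lemma IsFrechetSpace.prod {X Y : Type*} [AddCommGroup X] [AddCommGroup Y]
    [Module ℂ X] [Module ℂ Y] [TopologicalSpace X] [TopologicalSpace Y] (hX : IsFrechetSpace X)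
    (hY : IsFrechetSpace Y) : IsFrechetSpace (X × Y) := by
  obtain ⟨_, _, _, _, hX⟩ := hX
  obtain ⟨_, _, _, _, hY⟩ := hY
  refine ⟨inferInstance, inferInstance, inferInstance, inferInstance, ?_⟩
  let : UniformSpace X := IsTopologicalAddGroup.rightUniformSpace X
  have : IsUniformAddGroup X := isUniformAddGroup_of_addCommGroup
  let : UniformSpace Y := IsTopologicalAddGroup.rightUniformSpace Y
  have : IsUniformAddGroup Y := isUniformAddGroup_of_addCommGroup
  rw [IsUniformAddGroup.rightUniformSpace_eq]
  infer_instance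

lemma isFrechetSpace_of_banach {X : Type*} [NormedAddCommGroup X] [NormedSpace ℂ X]
    [hX : CompleteSpace X] : IsFrechetSpace X := by
  refine ⟨inferInstance, inferInstance, inferInstance, inferInstance, ?_⟩
  rwa [IsUniformAddGroup.rightUniformSpace_eq]

/-- The intersection embeds as the diagonal of the product. The diagonal is closed, being cut out by
the equations l (y i) = l (y j) for continuous separating functionals l. -/
lemma isFrechet_projLim [Countable ι] {E : ι → TopSubspace V} [Nonempty ι]
    (h : ∀ i, (E i).IsFrechet) {Λ : Set (V →ₗ[ℂ] ℂ)} (hΛ : ∀ v, (∀ l ∈ Λ, l v = 0) → v = 0)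
    (hE : ∀ i, (E i).ContinuousFunctionals Λ) : (projLim E).IsFrechet := by
  let φ : (projLim E).carrier →ₗ[ℂ] (∀ i, (E i).carrier) :=
    LinearMap.pi fun i => Submodule.inclusion (iInf_le _ i)
  obtain ⟨i₀⟩ := ‹Nonempty ι›
  refine IsFrechetSpace.of_induced (IsFrechetSpace.pi h) φ (fun x y hxy => ?_) ?_ ?_
  · exact Submodule.inclusion_injective (iInf_le _ i₀) (congrFun hxy i₀)
  · simp only [Pi.topologicalSpace, induced_iInf, induced_compose]
    rfl
  · have : Set.range φ = ⋂ i, ⋂ j, ⋂ l : Λ, {y | l.1 (y i) = l.1 (y j)} := by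
      ext y
      simp only [Set.mem_range, Set.mem_iInter, Set.mem_ofPred_eq]
      constructor
      · rintro ⟨x, rfl⟩ i j l
        rfl
      · intro hy
        have hij : ∀ i j, (y i : V) = y j := fun i j => by
          refine sub_eq_zero.1 (hΛ _ fun l hl => ?_)
          rw [map_sub, sub_eq_zero]
          exact hy i j ⟨l, hl⟩
        refine ⟨⟨y i₀, Submodule.mem_iInf _ |>.2 fun i => hij i₀ i ▸ (y i).2⟩, ?_⟩
        funext i
        exact Subtype.ext (hij i₀ i)
    rw [this]
    exact isClosed_iInter fun i => isClosed_iInter fun j => isClosed_iInter fun l =>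
      isClosed_eq ((hE i l.1 l.2).comp (continuous_apply i))
        ((hE j l.1 l.2).comp (continuous_apply j))

lemma TopSubspace.isFrechet_of_eq_bot {E : TopSubspace V} (h : E.carrier = ⊥) : E.IsFrechet := by
  have : Subsingleton E.carrier := by rw [h]; infer_instance
  refine IsFrechetSpace.of_induced (Y := ℂ) isFrechetSpace_of_banach 0
    (fun _ _ _ => Subsingleton.elim _ _) (Subsingleton.elim _ _) ?_
  exact (Set.subsingleton_range (fun _ => (0 : ℂ))).isClosed

/-! ### Matrices of spaces -/

section Matrix

variable {A B C D : TopSubspace V}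

/-- Along a bijection, coinducing is the same as inducing along the inverse; the induced form is the
one that transports vector space properties. -/
lemma matrixSpace_induced (h : Function.Injective (sumMap A B C D)) :
    ∃ e : (matrixSpace A B C D).carrier ≃ₗ[ℂ]
        (A.carrier × B.carrier) × (C.carrier × D.carrier),
      (matrixSpace A B C D).top = TopologicalSpace.induced e inferInstance := by
  let e := LinearEquiv.ofInjective (sumMap A B C D) h
  refine ⟨e.symm, ?_⟩
  exact (Equiv.induced_symm e.toEquiv).symm ▸ rfl

lemma isFrechet_matrixSpace (h : Function.Injective (sumMap A B C D)) (hA : A.IsFrechet)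
    (hB : B.IsFrechet) (hC : C.IsFrechet) (hD : D.IsFrechet) :
    (matrixSpace A B C D).IsFrechet := by
  obtain ⟨e, he⟩ := matrixSpace_induced h
  refine IsFrechetSpace.of_induced ((hA.prod hB).prod (hC.prod hD)) e.toLinearMap
    e.injective he ?_
  rw [LinearEquiv.coe_coe, e.surjective.range_eq]
  exact isClosed_univ

lemma isLocallyConvex_matrixSpace (h : Function.Injective (sumMap A B C D))
    (hA : A.IsLocallyConvex) (hB : B.IsLocallyConvex) (hC : C.IsLocallyConvex)
    (hD : D.IsLocallyConvex) : (matrixSpace A B C D).IsLocallyConvex := by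
  obtain ⟨e, he⟩ := matrixSpace_induced h
  obtain ⟨_, _, _⟩ := hA
  obtain ⟨_, _, _⟩ := hB
  obtain ⟨_, _, _⟩ := hC
  obtain ⟨_, _, _⟩ := hD
  refine ⟨?_, ?_, ?_⟩ <;> rw [he]
  · exact topologicalAddGroup_induced e
  · exact continuousSMul_induced e.toLinearMap
  · exact LocallyConvexSpace.induced (e.toLinearMap.restrictScalars ℝ)

lemma continuous_rangeRestrict_sumMap (A B C D : TopSubspace V) :
    Continuous (Y := (matrixSpace A B C D).carrier) (sumMap A B C D).rangeRestrict :=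
  continuous_coinduced_rng

lemma sumMap_apply (x : (A.carrier × B.carrier) × (C.carrier × D.carrier)) :
    sumMap A B C D x = (x.1.1 + x.1.2 : V) + (x.2.1 + x.2.2) := rfl

lemma le_matrixSpace₁₁ : A ≤ matrixSpace A B C D := by
  have h (x : A.carrier) : sumMap A B C D ((x, 0), (0, 0)) = x := by simp [sumMap_apply]
  refine ⟨fun x hx => ⟨((⟨x, hx⟩, 0), (0, 0)), h _⟩, ?_⟩
  have h2 : Continuous fun x : A.carrier => (((x, 0), (0, 0)) :
      (A.carrier × B.carrier) × (C.carrier × D.carrier)) := by fun_prop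
  have h3 := (continuous_rangeRestrict_sumMap A B C D).comp h2
  exact h3.congr fun x => Subtype.ext (h x)

lemma le_matrixSpace₁₂ : B ≤ matrixSpace A B C D := by
  have h (x : B.carrier) : sumMap A B C D ((0, x), (0, 0)) = x := by simp [sumMap_apply]
  refine ⟨fun x hx => ⟨((0, ⟨x, hx⟩), (0, 0)), h _⟩, ?_⟩
  have h2 : Continuous fun x : B.carrier => (((0, x), (0, 0)) :
      (A.carrier × B.carrier) × (C.carrier × D.carrier)) := by fun_prop
  have h3 := (continuous_rangeRestrict_sumMap A B C D).comp h2
  exact h3.congr fun x => Subtype.ext (h x)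

lemma le_matrixSpace₂₁ : C ≤ matrixSpace A B C D := by
  have h (x : C.carrier) : sumMap A B C D ((0, 0), (x, 0)) = x := by simp [sumMap_apply]
  refine ⟨fun x hx => ⟨((0, 0), (⟨x, hx⟩, 0)), h _⟩, ?_⟩
  have h2 : Continuous fun x : C.carrier => (((0, 0), (x, 0)) :
      (A.carrier × B.carrier) × (C.carrier × D.carrier)) := by fun_prop
  have h3 := (continuous_rangeRestrict_sumMap A B C D).comp h2
  exact h3.congr fun x => Subtype.ext (h x)

lemma le_matrixSpace₂₂ : D ≤ matrixSpace A B C D := by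
  have h (x : D.carrier) : sumMap A B C D ((0, 0), (0, x)) = x := by simp [sumMap_apply]
  refine ⟨fun x hx => ⟨((0, 0), (0, ⟨x, hx⟩)), h _⟩, ?_⟩
  have h2 : Continuous fun x : D.carrier => (((0, 0), (0, x)) :
      (A.carrier × B.carrier) × (C.carrier × D.carrier)) := by fun_prop
  have h3 := (continuous_rangeRestrict_sumMap A B C D).comp h2
  exact h3.congr fun x => Subtype.ext (h x)

lemma matrixSpace_le {G : TopSubspace V} (hG : IsTopologicalAddGroup G.carrier)
    (hA : A ≤ G) (hB : B ≤ G) (hC : C ≤ G) (hD : D ≤ G) : matrixSpace A B C D ≤ G := by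
  obtain ⟨iA, hA⟩ := hA
  obtain ⟨iB, hB⟩ := hB
  obtain ⟨iC, hC⟩ := hC
  obtain ⟨iD, hD⟩ := hD
  have h : (matrixSpace A B C D).carrier ≤ G.carrier := by
    rintro _ ⟨x, rfl⟩
    exact G.carrier.add_mem (G.carrier.add_mem (iA x.1.1.2) (iB x.1.2.2))
      (G.carrier.add_mem (iC x.2.1.2) (iD x.2.2.2))
  refine ⟨h, continuous_coinduced_dom.2 ?_⟩
  have : Continuous fun x : (A.carrier × B.carrier) × (C.carrier × D.carrier) =>
      (Submodule.inclusion iA x.1.1 + Submodule.inclusion iB x.1.2) +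
      (Submodule.inclusion iC x.2.1 + Submodule.inclusion iD x.2.2) := by fun_prop
  exact this

lemma continuousFunctionals_matrixSpace {Λ : Set (V →ₗ[ℂ] ℂ)} (hA : A.ContinuousFunctionals Λ)
    (hB : B.ContinuousFunctionals Λ) (hC : C.ContinuousFunctionals Λ)
    (hD : D.ContinuousFunctionals Λ) : (matrixSpace A B C D).ContinuousFunctionals Λ := by
  intro l hl
  refine continuous_coinduced_dom.2 ?_
  have h := (((hA l hl).comp (continuous_fst.comp continuous_fst)).add
    ((hB l hl).comp (continuous_snd.comp continuous_fst))).add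
    (((hC l hl).comp (continuous_fst.comp continuous_snd)).add
    ((hD l hl).comp (continuous_snd.comp continuous_snd)))
  refine h.congr fun x => ?_
  change (l x.1.1 + l x.1.2) + (l x.2.1 + l x.2.2) = l (sumMap A B C D x)
  rw [sumMap_apply, map_add, map_add, map_add]

lemma sumMap_injective_of_le {D' : TopSubspace V} (h : Function.Injective (sumMap A B C D'))
    (hD : D.carrier ≤ D'.carrier) : Function.Injective (sumMap A B C D) := by
  have : sumMap A B C D = sumMap A B C D' ∘ₗ
      (LinearMap.id.prodMap (LinearMap.id.prodMap (Submodule.inclusion hD))) := rfl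
  rw [this, LinearMap.coe_comp]
  refine h.comp ?_
  exact Function.injective_id.prodMap
    (Function.injective_id.prodMap (Submodule.inclusion_injective hD))

/-- Both inclusions follow from universal properties. Injectivity serves only to make the left side
locally convex, and an index is needed to place the three fixed entries in the right side. -/
lemma matrixSpace_indLim [Nonempty ι] {L : ι → TopSubspace V} (hA : A.IsLocallyConvex)
    (hB : B.IsLocallyConvex) (hC : C.IsLocallyConvex)
    (h : Function.Injective (sumMap A B C (indLim L))) :
    matrixSpace A B C (indLim L) = indLim fun i => matrixSpace A B C (L i) := by
  have i₀ : ι := Classical.arbitrary ι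
  have hE := isLocallyConvex_matrixSpace h hA hB hC (isLocallyConvex_indLim L)
  have hF := isLocallyConvex_indLim fun i => matrixSpace A B C (L i)
  have key (i : ι) : matrixSpace A B C (L i) ≤ indLim fun i => matrixSpace A B C (L i) :=
    le_indLim (fun i => matrixSpace A B C (L i)) i
  refine le_antisymm (matrixSpace_le hF.1 ?_ ?_ ?_ ?_) (indLim_le hE fun i => ?_)
  · exact le_matrixSpace₁₁.trans (key i₀)
  · exact le_matrixSpace₁₂.trans (key i₀)
  · exact le_matrixSpace₂₁.trans (key i₀)
  · exact indLim_le hF fun i => le_matrixSpace₂₂.trans (key i)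
  · exact matrixSpace_le hE.1 le_matrixSpace₁₁ le_matrixSpace₁₂ le_matrixSpace₂₁
      ((le_indLim L i).trans le_matrixSpace₂₂)

end Matrix

end General

/-! ### Spaces of forms as Banach quotients of the von Neumann algebra -/

section Forms

variable {H : Type*} [NormedAddCommGroup H] [InnerProductSpace ℂ H]

attribute [local instance] TopSubspace.top

variable {D : Submodule ℂ H} (a b : H →ₗ.[ℂ] H) (ha : D ≤ a.domain) (hb : D ≤ b.domain)

lemma hatForm_apply (x : H →L[ℂ] H) (f g : D) : hatForm a b ha hb x f g =
    inner ℂ (a (Submodule.inclusion ha g)) (x (b (Submodule.inclusion hb f))) := rfl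

/-- Evaluation of a form. -/
def evalForm (f g : D) : Form D →ₗ[ℂ] ℂ where
  toFun y := y f g
  map_add' _ _ := rfl
  map_smul' _ _ := rfl

variable (D) in
/-- All evaluations of forms on `D`. -/
def evaluations : Set (Form D →ₗ[ℂ] ℂ) := Set.range fun p : D × D => evalForm p.1 p.2

lemma eq_zero_of_evaluations (y : Form D) (h : ∀ l ∈ evaluations D, l y = 0) : y = 0 := by
  ext f g
  exact h _ ⟨(f, g), rfl⟩

variable [CompleteSpace H]

/-- The elements of a von Neumann algebra as a linear subspace of the bounded operators. -/
abbrev toSubmodule (M : VonNeumannAlgebra H) : Submodule ℂ (H →L[ℂ] H) :=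
  Subalgebra.toSubmodule M.toStarSubalgebra.toSubalgebra

lemma isClosed_toSubmodule (M : VonNeumannAlgebra H) :
    IsClosed (toSubmodule M : Set (H →L[ℂ] H)) := by
  have h : (toSubmodule M : Set (H →L[ℂ] H)) =
      ⋂ y ∈ M.commutant, {x : H →L[ℂ] H | y * x = x * y} := by
    ext x
    have : x ∈ M ↔ _ := (SetLike.ext_iff.1 M.commutant_commutant x).symm.trans
      VonNeumannAlgebra.mem_commutant_iff
    simpa using this
  rw [h]
  exact isClosed_biInter fun y _ => isClosed_eq (by fun_prop) (by fun_prop)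

instance (M : VonNeumannAlgebra H) : CompleteSpace (toSubmodule M) :=
  (isClosed_toSubmodule M).completeSpace_coe

variable (M : VonNeumannAlgebra H)

/-- The map of `M` onto the space of forms which it induces. -/
def toFormSpace : toSubmodule M →ₗ[ℂ] (formSpace M a b ha hb).carrier :=
  (hatForm a b ha hb).submoduleMap (toSubmodule M)

lemma coe_toFormSpace (x : toSubmodule M) :
    (toFormSpace a b ha hb M x : Form D) = hatForm a b ha hb x := rfl

lemma toFormSpace_surjective : Function.Surjective (toFormSpace a b ha hb M) :=
  (hatForm a b ha hb).submoduleMap_surjective (toSubmodule M)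

/-- The infimum over all representatives is the quotient norm of `M` modulo the operators inducing
the zero form. -/
lemma formSpace_top_eq_coinduced : (formSpace M a b ha hb).top =
    TopologicalSpace.coinduced (toFormSpace a b ha hb M) inferInstance := by
  set N : (formSpace M a b ha hb).carrier → ℝ := fun y =>
    sInf {r : ℝ | ∃ x : H →L[ℂ] H, x ∈ M ∧ hatForm a b ha hb x = (y : Form D) ∧ ‖x‖ = r}
  refine TopologicalSpace.ext_iff.2 fun U => ?_
  change (∀ y ∈ U, ∃ ε : ℝ, 0 < ε ∧ ∀ z, N (z - y) < ε → z ∈ U) ↔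
    IsOpen (toFormSpace a b ha hb M ⁻¹' U)
  rw [Metric.isOpen_iff]
  constructor
  · intro h x hx
    obtain ⟨ε, hε, h⟩ := h _ hx
    refine ⟨ε, hε, fun z hz => h _ (lt_of_le_of_lt ?_ (mem_ball_iff_norm.1 hz))⟩
    refine csInf_le ⟨0, ?_⟩ ⟨z - x, (toSubmodule M).sub_mem z.2 x.2, ?_, rfl⟩
    · rintro _ ⟨x, -, -, rfl⟩
      exact norm_nonneg x
    · rw [map_sub]
      rfl
  · intro h y hy
    obtain ⟨x, rfl⟩ := toFormSpace_surjective a b ha hb M y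
    obtain ⟨ε, hε, h⟩ := h x hy
    refine ⟨ε, hε, fun z hz => ?_⟩
    obtain ⟨z, rfl⟩ := toFormSpace_surjective a b ha hb M z
    -- The representative z may be far from x, but x + w with ‖w‖ < ε induces the same form.
    obtain ⟨_, ⟨w, hw, hwz, rfl⟩, hlt⟩ := exists_lt_of_csInf_lt
      (s := {r : ℝ | ∃ w : H →L[ℂ] H, w ∈ M ∧ hatForm a b ha hb w =
        ((toFormSpace a b ha hb M z - toFormSpace a b ha hb M x :
          (formSpace M a b ha hb).carrier) : Form D) ∧ ‖w‖ = r})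
      ⟨_, z - x, (toSubmodule M).sub_mem z.2 x.2, by rw [map_sub]; rfl, rfl⟩ hz
    have hmem := h (show x + ⟨w, hw⟩ ∈ Metric.ball x ε by simpa using hlt)
    have : toFormSpace a b ha hb M (x + ⟨w, hw⟩) = toFormSpace a b ha hb M z := by
      refine Subtype.ext ?_
      rw [map_add, Submodule.coe_add, coe_toFormSpace, coe_toFormSpace, hwz]
      exact add_sub_cancel _ _
    rwa [Set.mem_preimage, this] at hmem

lemma continuous_toFormSpace : Continuous (toFormSpace a b ha hb M) :=
  continuous_iff_coinduced_le.2 (formSpace_top_eq_coinduced a b ha hb M).ge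

lemma continuous_formSpace_dom {Z : Type*} [TopologicalSpace Z]
    {φ : (formSpace M a b ha hb).carrier → Z}
    (h : Continuous (φ ∘ toFormSpace a b ha hb M)) : Continuous φ := by
  rw [continuous_iff_coinduced_le, formSpace_top_eq_coinduced, coinduced_compose]
  exact continuous_iff_coinduced_le.1 h

lemma continuousFunctionals_formSpace :
    (formSpace M a b ha hb).ContinuousFunctionals (evaluations D) := by
  rintro _ ⟨⟨f, g⟩, rfl⟩
  refine continuous_formSpace_dom a b ha hb M ?_
  change Continuous fun x : toSubmodule M => inner ℂ (a (Submodule.inclusion ha g))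
    ((x : H →L[ℂ] H) (b (Submodule.inclusion hb f)))
  fun_prop

/-- The kernel of `M` → forms is an intersection of kernels of continuous evaluations, hence closed,
so the quotient is a Banach space. -/
lemma isFrechet_formSpace : (formSpace M a b ha hb).IsFrechet := by
  set π := toFormSpace a b ha hb M
  have hK : IsClosed (π.ker : Set (toSubmodule M)) := by
    have : (π.ker : Set (toSubmodule M)) = ⋂ l ∈ evaluations D, {x | l (π x) = 0} := by
      ext x
      simp only [SetLike.mem_coe, LinearMap.mem_ker, Set.mem_iInter, Set.mem_ofPred_eq]
      refine ⟨fun h l _ => by rw [h]; exact map_zero l, fun h => Subtype.ext ?_⟩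
      exact eq_zero_of_evaluations _ h
    rw [this]
    exact isClosed_biInter fun l hl => isClosed_eq
      ((continuousFunctionals_formSpace a b ha hb M l hl).comp
        (continuous_toFormSpace a b ha hb M)) continuous_const
  have hsurj : Function.Surjective π := toFormSpace_surjective a b ha hb M
  let e := @LinearMap.quotKerEquivOfSurjective ℂ (toSubmodule M) (formSpace M a b ha hb).carrier
    _ _ _ _ _ π hsurj
  refine IsFrechetSpace.of_induced (isFrechetSpace_of_banach (X := toSubmodule M ⧸ π.ker))
    e.symm.toLinearMap e.symm.injective ?_ ?_
  · have h1 : (formSpace M a b ha hb).top = TopologicalSpace.coinduced e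
        (TopologicalSpace.coinduced π.ker.mkQ inferInstance) := by
      rw [formSpace_top_eq_coinduced, coinduced_compose]
      rfl
    rw [h1]
    exact congrFun (Equiv.induced_symm e.toEquiv).symm _
  · rw [LinearEquiv.coe_coe, e.symm.surjective.range_eq]
    exact isClosed_univ

variable {a b ha hb} in
-- Bounded factors move into the operator: ⟨x d b' f, c a' g⟩ = ⟨(c* x d) b' f, a' g⟩, and x ↦ c* x
-- d is continuous on `M`.
lemma formSpace_le {a' b' : H →ₗ.[ℂ] H} {ha' : D ≤ a'.domain} {hb' : D ≤ b'.domain}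
    {c d : H →L[ℂ] H} (hc : c ∈ M) (hd : d ∈ M)
    (hac : ∀ f : D, a (Submodule.inclusion ha f) = c (a' (Submodule.inclusion ha' f)))
    (hbd : ∀ f : D, b (Submodule.inclusion hb f) = d (b' (Submodule.inclusion hb' f))) :
    formSpace M a b ha hb ≤ formSpace M a' b' ha' hb' := by
  have hmem (x : toSubmodule M) : star c * x * d ∈ toSubmodule M :=
    mul_mem (S := VonNeumannAlgebra H) (mul_mem (star_mem hc) x.2) hd
  have key (x : H →L[ℂ] H) : hatForm a b ha hb x = hatForm a' b' ha' hb' (star c * x * d) := by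
    ext f g
    rw [hatForm_apply, hatForm_apply, hac, hbd, ContinuousLinearMap.star_eq_adjoint,
      mul_apply_eq_comp, mul_apply_eq_comp,
      ContinuousLinearMap.adjoint_inner_right]
  refine ⟨?_, continuous_formSpace_dom a b ha hb M ?_⟩
  · rintro _ ⟨x, hx, rfl⟩
    exact ⟨_, hmem ⟨x, hx⟩, (key x).symm⟩
  · have : Continuous fun x : toSubmodule M => (⟨star c * x * d, hmem x⟩ : toSubmodule M) := by
      fun_prop
    refine ((continuous_toFormSpace a' b' ha' hb' M).comp this).congr fun x => ?_
    exact Subtype.ext (key x).symm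

end Forms

/-! ### Resolvents of positive operators and membership in von Neumann algebras -/

section Operators

variable {H : Type*} [NormedAddCommGroup H] [InnerProductSpace ℂ H]

/-- `S` is the bounded inverse `(1 + X)⁻¹`. -/
structure IsResolvent (X : H →ₗ.[ℂ] H) (S : H →L[ℂ] H) : Prop where
  mem : ∀ v, S v ∈ X.domain
  add_apply : ∀ v, S v + X ⟨S v, mem v⟩ = v
  apply_add : ∀ f : X.domain, S (f + X f) = f

namespace IsResolvent

variable {X : H →ₗ.[ℂ] H} {S : H →L[ℂ] H}

lemma resolvent_eq (h : IsResolvent X S) : resolvent X = S := by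
  have hex : ∃ R : H →L[ℂ] H, ∀ v : H, ∃ hv : R v ∈ X.domain, R v + X ⟨R v, hv⟩ = v :=
    ⟨S, fun v => ⟨h.mem v, h.add_apply v⟩⟩
  rw [resolvent, dif_pos hex]
  ext v
  obtain ⟨hv, e⟩ := hex.choose_spec v
  have := h.apply_add ⟨_, hv⟩
  rw [e] at this
  exact this.symm

lemma eq_zero_of_apply (h : IsResolvent X S) {v : H} (hv : S v = 0) : v = 0 := by
  have h1 : (⟨S v, h.mem v⟩ : X.domain) = 0 := Subtype.ext hv
  have h2 := h.add_apply v
  rwa [h1, LinearPMap.map_zero, hv, add_zero, eq_comm] at h2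

/-- On ran p the operator X p acts as X, with resolvent S; on ker p it is zero, with resolvent 1. -/
lemma mulRight (h : IsResolvent X S) {p : H →L[ℂ] H} (hp : p * p = p) (hc : Commute S p) :
    IsResolvent (PowerLimit.mulRight X p) (S * p + (1 - p)) := by
  have hpp (v : H) : p (p v) = p v := DFunLike.congr_fun hp v
  have hcc (v : H) : p (S v) = S (p v) := (DFunLike.congr_fun hc.eq v).symm
  have hS (v : H) : (S * p + (1 - p)) v = S (p v) + (v - p v) := rfl
  have h1 (v : H) : p ((S * p + (1 - p)) v) = S (p v) := by
    simp [hpp, hcc]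
  have hmem (v : H) : (S * p + (1 - p)) v ∈ (PowerLimit.mulRight X p).domain := by
    change p _ ∈ X.domain
    rw [h1]
    exact h.mem _
  refine ⟨hmem, fun v => ?_, fun f => ?_⟩
  · have h2 : PowerLimit.mulRight X p ⟨_, hmem v⟩ = X ⟨S (p v), h.mem _⟩ := by
      change X ⟨_, _⟩ = _
      congr 2
      exact h1 v
    rw [h2, eq_sub_of_add_eq' (h.add_apply (p v)), hS]
    abel
  · obtain ⟨f, hf⟩ := f
    have hf' : p f ∈ X.domain := hf
    have h2 : PowerLimit.mulRight X p ⟨f, hf⟩ = X ⟨p f, hf'⟩ := rfl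
    rw [h2]
    have h3 := h.apply_add ⟨p f, hf'⟩
    set w := X ⟨p f, hf'⟩
    -- Injectivity of `S` shows that X maps p f back into ran p.
    have h4 : p (p f + w) - (p f + w) = 0 := h.eq_zero_of_apply (by
      rw [map_sub, ← hcc, h3, hpp, sub_self])
    have h5 : p w = w := by
      rw [map_add, hpp] at h4
      exact sub_eq_zero.1 (by rw [← h4]; abel)
    rw [map_add] at h3
    rw [map_add, hS, hS, h5, eq_sub_of_add_eq' h3]
    abel

end IsResolvent

variable [CompleteSpace H]

namespace IsPositiveSelfAdjoint

variable {a : H →ₗ.[ℂ] H} (ha : IsPositiveSelfAdjoint a)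
include ha

lemma inner_symm (f g : a.domain) : inner ℂ (a f) (g : H) = inner ℂ (f : H) (a g) := by
  have h := LinearPMap.adjoint_isFormalAdjoint ha.isSelfAdjoint.dense_domain
  rw [LinearPMap.isSelfAdjoint_def.1 ha.isSelfAdjoint] at h
  exact h f g

lemma norm_le_norm_add (f : a.domain) : ‖(f : H)‖ ≤ ‖(f : H) + a f‖ := by
  have h1 : ‖(f : H)‖ * ‖(f : H)‖ ≤ ‖(f : H)‖ * ‖(f : H) + a f‖ := by
    calc ‖(f : H)‖ * ‖(f : H)‖ ≤ RCLike.re (inner ℂ (f : H) ((f : H) + a f)) := by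
          rw [inner_add_right, map_add, inner_self_eq_norm_mul_norm]
          linarith [ha.nonneg f]
      _ ≤ _ := re_inner_le_norm _ _
  rcases (norm_nonneg (f : H)).eq_or_lt with h | h
  · rw [← h]
    exact norm_nonneg _
  · exact le_of_mul_le_mul_left h1 h

/-- The range of 1 + a is closed, since 1 + a is bounded below and the graph is closed. A vector g
orthogonal to it satisfies a* g = -g, so g lies in D(a) and positivity forces g = 0. -/
lemma add_surjective (v : H) : ∃ f : a.domain, (f : H) + a f = v := by
  let T : a.domain →ₗ[ℂ] H := a.domain.subtype + a.toFun
  have hclosed : IsClosed (T.range : Set H) := by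
    have hg : IsClosed (a.graph : Set (H × H)) := ha.isSelfAdjoint.isClosed
    let q : a.graph → H := fun x => x.1.1 + x.1.2
    -- The constant 2 comes from ‖a f‖ ≤ ‖f + a f‖ + ‖f‖ ≤ 2 ‖f + a f‖.
    have hq : AntilipschitzWith 2 q := by
      refine AntilipschitzWith.of_le_mul_dist fun x y => ?_
      obtain ⟨f, hf1, hf2⟩ := (LinearPMap.mem_graph_iff a).1 (a.graph.sub_mem x.2 y.2)
      have h1 := ha.norm_le_norm_add f
      have h2 : q x - q y = f + a f := by
        rw [hf1, hf2]
        simp only [q, Prod.fst_sub, Prod.snd_sub]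
        abel
      have h3 : ‖a f‖ ≤ ‖(f : H) + a f‖ + ‖(f : H)‖ := by
        simpa using norm_sub_le ((f : H) + a f) f
      rw [Subtype.dist_eq, dist_eq_norm, dist_eq_norm, h2, Prod.norm_def, ← hf1, ← hf2]
      refine max_le ?_ ?_ <;> push_cast <;> linarith [norm_nonneg ((f : H) + a f)]
    have : CompleteSpace a.graph := hg.completeSpace_coe
    have hu : UniformContinuous q := by
      have : UniformContinuous fun x : a.graph => x.1.1 + x.1.2 :=
        (uniformContinuous_fst.comp uniformContinuous_subtype_val).add
          (uniformContinuous_snd.comp uniformContinuous_subtype_val)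
      exact this
    convert hq.isClosed_range hu
    ext v
    constructor
    · rintro ⟨f, rfl⟩
      exact ⟨⟨(f, a f), a.mem_graph f⟩, rfl⟩
    · rintro ⟨⟨⟨x, y⟩, hx⟩, rfl⟩
      obtain ⟨f, rfl, rfl⟩ := (LinearPMap.mem_graph_iff a).1 hx
      exact ⟨f, rfl⟩
  have : CompleteSpace T.range := hclosed.completeSpace_coe
  have htop : T.range = ⊤ := by
    rw [← Submodule.orthogonal_eq_bot_iff, Submodule.eq_bot_iff]
    intro g hg
    have h0 (f : a.domain) : inner ℂ g ((f : H) + a f) = 0 :=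
      Submodule.inner_left_of_mem_orthogonal (K := T.range) ⟨f, rfl⟩ hg
    have h1 (f : a.domain) : inner ℂ (-g) (f : H) = inner ℂ g (a f) := by
      have := h0 f
      rw [inner_add_right] at this
      rw [inner_neg_left]
      linear_combination -this
    have h2 : g ∈ a.domain := by
      have := LinearPMap.mem_adjoint_domain_of_exists (T := a) g ⟨-g, h1⟩
      rwa [LinearPMap.isSelfAdjoint_def.1 ha.isSelfAdjoint] at this
    have h3 : inner ℂ g (g + a ⟨g, h2⟩) = 0 := h0 ⟨g, h2⟩
    have h4 := congrArg RCLike.re h3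
    rw [inner_add_right, map_add, inner_self_eq_norm_mul_norm, map_zero] at h4
    have h5 := ha.nonneg ⟨g, h2⟩
    have h6 : ‖g‖ * ‖g‖ = 0 := by
      have : 0 ≤ ‖g‖ * ‖g‖ := by positivity
      dsimp only at h5
      linarith
    simpa using h6
  obtain ⟨f, hf⟩ : v ∈ T.range := htop ▸ Submodule.mem_top
  exact ⟨f, hf⟩

lemma exists_isResolvent : ∃ R, IsResolvent a R := by
  let T : a.domain →ₗ[ℂ] H := a.domain.subtype + a.toFun
  have hT (f : a.domain) : T f = f + a f := rfl
  have hinj : Function.Injective T := by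
    rw [← LinearMap.ker_eq_bot, LinearMap.ker_eq_bot']
    intro f hf
    have := ha.norm_le_norm_add f
    rw [← hT, hf, norm_zero] at this
    exact Subtype.ext (norm_le_zero_iff.1 this)
  let e := LinearEquiv.ofBijective T ⟨hinj, fun v => ha.add_surjective v⟩
  have he (v : H) : (e.symm v : H) + a (e.symm v) = v := e.apply_symm_apply v
  let R : H →L[ℂ] H := (a.domain.subtype ∘ₗ e.symm.toLinearMap).mkContinuous 1 fun v => by
    have := ha.norm_le_norm_add (e.symm v)
    rw [he] at this
    simpa using this
  exact ⟨R, fun v => (e.symm v).2, he, fun f => congrArg Subtype.val (e.symm_apply_apply f)⟩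

lemma isResolvent : IsResolvent a (resolvent a) := by
  obtain ⟨R, hR⟩ := ha.exists_isResolvent
  rwa [hR.resolvent_eq]

lemma resolvent_nonneg : 0 ≤ resolvent a := by
  have hR := ha.isResolvent
  set R := resolvent a
  rw [ContinuousLinearMap.nonneg_iff_isPositive, ContinuousLinearMap.isPositive_def]
  refine ⟨fun v w => ?_, fun v => ?_⟩
  · have h := ha.inner_symm ⟨R v, hR.mem v⟩ ⟨R w, hR.mem w⟩
    have h1 : inner ℂ (R v) (R w + a ⟨R w, hR.mem w⟩) =
        inner ℂ (R v + a ⟨R v, hR.mem v⟩) (R w) := by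
      rw [inner_add_right, inner_add_left, h]
    rwa [hR.add_apply, hR.add_apply] at h1
  · have h1 : 0 ≤ RCLike.re (inner ℂ (R v) (R v + a ⟨R v, hR.mem v⟩)) := by
      rw [inner_add_right, map_add, inner_self_eq_norm_mul_norm]
      exact add_nonneg (by positivity) (ha.nonneg ⟨R v, hR.mem v⟩)
    rwa [hR.add_apply] at h1

lemma resolvent_le_one : resolvent a ≤ 1 := by
  have hR := ha.isResolvent
  have hsa : IsSelfAdjoint (resolvent a) := .of_nonneg ha.resolvent_nonneg
  set R := resolvent a
  rw [← sub_nonneg, ContinuousLinearMap.nonneg_iff_isPositive, ContinuousLinearMap.isPositive_def]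
  refine ⟨((IsSelfAdjoint.one _).sub hsa).isSymmetric, fun v => ?_⟩
  -- Writing v = Rv + aRv turns ⟨(1 - R)v, v⟩ into ⟨aRv, Rv⟩ + ‖aRv‖².
  have h1 : (1 - R) v = a ⟨R v, hR.mem v⟩ := sub_eq_of_eq_add' (hR.add_apply v).symm
  have h2 : 0 ≤ RCLike.re (inner ℂ (a ⟨R v, hR.mem v⟩) (R v + a ⟨R v, hR.mem v⟩)) := by
    rw [inner_add_right, map_add, inner_self_eq_norm_mul_norm, inner_re_symm]
    exact add_nonneg (ha.nonneg ⟨R v, hR.mem v⟩) (by positivity)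
  rw [hR.add_apply, ← h1] at h2
  exact h2

end IsPositiveSelfAdjoint

/-! ### Membership in von Neumann algebras -/

/-- Affiliation tests unitaries only, the bicommutant theorem all of the commutant; the unitaries of
a C*-algebra span it. -/
lemma mem_of_commute_unitary {N : VonNeumannAlgebra H} {T : H →L[ℂ] H}
    (h : ∀ u ∈ unitary (H →L[ℂ] H), u ∈ N.commutant → Commute u T) : T ∈ N := by
  rw [← N.commutant_commutant, VonNeumannAlgebra.mem_commutant_iff]
  have : IsClosed (N.commutant.toStarSubalgebra : Set (H →L[ℂ] H)) :=
    isClosed_toSubmodule N.commutant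
  let A := N.commutant.toStarSubalgebra
  have hspan : (⊤ : Submodule ℂ A) ≤
      (Subalgebra.toSubmodule (Subalgebra.centralizer ℂ {T})).comap A.subtype.toLinearMap := by
    rw [← CStarAlgebra.span_unitary, Submodule.span_le]
    intro u hu
    have hu' : (u : H →L[ℂ] H) ∈ unitary (H →L[ℂ] H) := by
      rw [SetLike.mem_coe, Unitary.mem_iff] at hu
      rw [Unitary.mem_iff]
      exact ⟨congrArg Subtype.val hu.1, congrArg Subtype.val hu.2⟩
    have := h u hu' u.2
    refine (Subalgebra.mem_centralizer_iff ℂ).2 fun T' hT' => ?_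
    rw [Set.mem_singleton_iff.1 hT']
    exact this.symm.eq
  intro y hy
  have := hspan (Submodule.mem_top (x := (⟨y, hy⟩ : A)))
  exact ((Subalgebra.mem_centralizer_iff ℂ).1 this T rfl).symm

lemma cfc_mem (N : VonNeumannAlgebra H) {T : H →L[ℂ] H} (hT : T ∈ N) (f : ℝ → ℝ) :
    cfc f T ∈ N := by
  rw [← N.commutant_commutant, VonNeumannAlgebra.mem_commutant_iff] at hT ⊢
  exact fun y hy => (Commute.cfc_real (show Commute T y from (hT y hy).symm) f).symm.eq

/-- Operators of the commutant commute with `T`, so they leave its kernel invariant. -/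
lemma starProjection_ker_mem (N : VonNeumannAlgebra H) {T : H →L[ℂ] H} (hT : T ∈ N) :
    (LinearMap.ker (T : H →ₗ[ℂ] H)).starProjection ∈ N := by
  rw [VonNeumannAlgebra.IsStarProjection.mem_iff isStarProjection_starProjection]
  intro y hy
  rw [← N.commutant_commutant, VonNeumannAlgebra.mem_commutant_iff] at hT
  have h : ((LinearMap.ker (T : H →ₗ[ℂ] H)).starProjection).range = T.ker :=
    Submodule.range_starProjection _
  rw [h, Module.End.mem_invtSubmodule]
  intro v hv
  have := DFunLike.congr_fun (hT y hy) v
  have hv' : T v = 0 := hv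
  change T (y v) = 0
  rw [← mul_apply_eq_comp, ← hT y hy, mul_apply_eq_comp, hv', map_zero]

lemma commute_of_mem_center {M : VonNeumannAlgebra H} {T x : H →L[ℂ] H} (hT : T ∈ center M)
    (hx : x ∈ M) : Commute T x :=
  (VonNeumannAlgebra.mem_commutant_iff.1 (show T ∈ M.commutant from hT.2) x hx).symm

lemma resolvent_mem {N : VonNeumannAlgebra H} {a : H →ₗ.[ℂ] H} (ha : IsPositiveSelfAdjoint a)
    (haff : IsAffiliated a N) : resolvent a ∈ N := by
  have hR := ha.isResolvent
  refine mem_of_commute_unitary fun u hu huN => ?_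
  ext v
  obtain ⟨h1, h2⟩ := haff u hu huN ⟨_, hR.mem v⟩
  have h3 := hR.apply_add ⟨_, h1⟩
  rw [h2] at h3
  dsimp only at h3
  rw [← map_add, hR.add_apply] at h3
  exact h3.symm

end Operators

/-! ### Powers of a positive operator through its resolvent -/

section Powers

variable {H : Type*} [NormedAddCommGroup H] [InnerProductSpace ℂ H] [CompleteSpace H]

lemma cfc_mul_apply {S : H →L[ℂ] H} {f g k : ℝ → ℝ} (hf : ContinuousOn f (spectrum ℝ S))
    (hg : ContinuousOn g (spectrum ℝ S)) (h : ∀ r ∈ spectrum ℝ S, f r * g r = k r) (v : H) :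
    cfc f S (cfc g S v) = cfc k S v := by
  rw [← cfc_congr h, cfc_mul f g S, mul_apply_eq_comp]

lemma rpow_add_apply {T : H →L[ℂ] H} (hT : 0 ≤ T) {s t : ℝ} (hs : 0 < s) (ht : 0 < t) (v : H) :
    (T ^ s) ((T ^ t) v) = (T ^ (s + t)) v := by
  rw [CFC.rpow_eq_cfc_real hT, CFC.rpow_eq_cfc_real hT, CFC.rpow_eq_cfc_real hT]
  refine cfc_mul_apply (continuous_id.rpow_const fun _ => Or.inr hs.le).continuousOn
    (continuous_id.rpow_const fun _ => Or.inr ht.le).continuousOn (fun r hr => ?_) v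
  exact (Real.rpow_add_of_nonneg (spectrum_nonneg_of_nonneg hT hr) hs.le ht.le).symm

/-- From ‖T^(s/2) v‖² = ⟨T^s v, v⟩ the exponent can be halved until it is below t; then T^t factors
through the small power. -/
lemma rpow_apply_eq_zero {T : H →L[ℂ] H} (hT : 0 ≤ T) {s t : ℝ} (hs : 0 < s) (ht : 0 < t) {v : H}
    (hv : (T ^ s) v = 0) : (T ^ t) v = 0 := by
  have half {s : ℝ} (hs : 0 < s) (hv : (T ^ s) v = 0) : (T ^ (s / 2)) v = 0 := by
    have hsa : IsSelfAdjoint (T ^ (s / 2)) := .of_nonneg CFC.rpow_nonneg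
    have h1 : inner ℂ ((T ^ (s / 2)) v) ((T ^ (s / 2)) v) = 0 := by
      have h2 := hsa.isSymmetric ((T ^ (s / 2)) v) v
      rw [ContinuousLinearMap.coe_coe, rpow_add_apply hT (half_pos hs) (half_pos hs), add_halves,
        hv, inner_zero_left] at h2
      exact h2.symm
    exact inner_self_eq_zero.1 h1
  have hn (n : ℕ) : (T ^ (s / 2 ^ n)) v = 0 := by
    induction n with
    | zero => simpa using hv
    | succ n ih =>
      have := half (by positivity) ih
      rwa [div_div, ← pow_succ] at this
  obtain ⟨n, hlt⟩ : ∃ n : ℕ, s / 2 ^ n < t := by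
    obtain ⟨n, hn⟩ := pow_unbounded_of_one_lt (s / t) (one_lt_two (α := ℝ))
    exact ⟨n, by rw [div_lt_iff₀ ht] at hn; rw [div_lt_iff₀ (by positivity)]; linarith⟩
  have := rpow_add_apply hT (sub_pos.2 hlt) (show 0 < s / 2 ^ n by positivity) v
  rw [hn, map_zero, sub_add_cancel] at this
  exact this.symm

lemma one_sub_rpow_eq_cfc {S : H →L[ℂ] H} (h0 : 0 ≤ S) (h1 : S ≤ 1) {γ : ℝ} (hγ : 0 < γ) :
    (1 - S) ^ γ = cfc (fun r : ℝ => (1 - r) ^ γ) S := by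
  have hsa : IsSelfAdjoint S := .of_nonneg h0
  have h : 1 - S = cfc (fun r : ℝ => 1 - r) S := by
    rw [cfc_sub (fun _ => (1 : ℝ)) (fun r => r) S, cfc_const_one ℝ S, cfc_id' ℝ S]
  rw [CFC.rpow_eq_cfc_real (sub_nonneg.2 h1), h]
  exact (cfc_comp' (fun r : ℝ => r ^ γ) (fun r => 1 - r) S
    (continuous_id.rpow_const fun _ => Or.inr hγ.le).continuousOn).symm

/-- `S` is the bounded inverse `(1 + X)⁻¹` of a positive operator. -/
structure IsPositiveResolvent (X : H →ₗ.[ℂ] H) (S : H →L[ℂ] H) : Prop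
    extends IsResolvent X S where
  nonneg : 0 ≤ S
  le_one : S ≤ 1

namespace IsPositiveResolvent

variable {X : H →ₗ.[ℂ] H} {S : H →L[ℂ] H} (h : IsPositiveResolvent X S)
include h

lemma spectrum_le_one {r : ℝ} (hr : r ∈ spectrum ℝ S) : r ≤ 1 :=
  (CFC.le_one_iff S (.of_nonneg h.nonneg)).1 h.le_one r hr

lemma rpow_injective {γ : ℝ} (hγ : 0 < γ) : Function.Injective (S ^ γ : H →L[ℂ] H) := by
  refine (injective_iff_map_eq_zero _).2 fun v hv => h.eq_zero_of_apply ?_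
  have := rpow_apply_eq_zero h.nonneg hγ one_pos hv
  rwa [CFC.rpow_one S h.nonneg] at this

lemma mem_opPow_domain {γ : ℝ} {f : H} :
    f ∈ (opPow X γ).domain ↔ ∃ v, (S ^ γ : H →L[ℂ] H) v = f := by
  rw [opPow, Submodule.toLinearPMap_domain, h.resolvent_eq]
  simp

lemma opPow_apply {γ : ℝ} (hγ : 0 < γ) (f : (opPow X γ).domain) {v : H}
    (hv : (S ^ γ : H →L[ℂ] H) v = f) : opPow X γ f = ((1 - S) ^ γ : H →L[ℂ] H) v := by
  -- The range defining `opPow` is the graph of a function because S^γ is injective.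
  have hg : ∀ x ∈ LinearMap.range (((resolvent X ^ γ : H →L[ℂ] H) : H →ₗ[ℂ] H).prod
      (((1 - resolvent X) ^ γ : H →L[ℂ] H) : H →ₗ[ℂ] H)), x.1 = 0 → x.2 = 0 := by
    rw [h.resolvent_eq]
    rintro _ ⟨w, rfl⟩ hw
    have : w = 0 := h.rpow_injective hγ (hw.trans (map_zero _).symm)
    simp [this]
  obtain ⟨w, hw⟩ := Submodule.mem_graph_toLinearPMap hg f
  have h1 : (resolvent X ^ γ : H →L[ℂ] H) w = f := congrArg Prod.fst hw
  have h2 : ((1 - resolvent X) ^ γ : H →L[ℂ] H) w = opPow X γ f := congrArg Prod.snd hw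
  rw [h.resolvent_eq] at h1 h2
  obtain rfl : w = v := h.rpow_injective hγ (h1.trans hv.symm)
  exact h2.symm

lemma map_mem {γ : ℝ} {T : H →L[ℂ] H} (hT : Commute S T) {f : H} (hf : f ∈ (opPow X γ).domain) :
    T f ∈ (opPow X γ).domain := by
  obtain ⟨v, rfl⟩ := h.mem_opPow_domain.1 hf
  have hc : Commute (S ^ γ) T := CFC.rpow_eq_cfc_real h.nonneg ▸ hT.cfc_real _
  exact h.mem_opPow_domain.2 ⟨T v, DFunLike.congr_fun hc.eq v⟩

lemma opPow_map {γ : ℝ} (hγ : 0 < γ) {T : H →L[ℂ] H} (hT : Commute S T)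
    (f : (opPow X γ).domain) : opPow X γ ⟨T f, h.map_mem hT f.2⟩ = T (opPow X γ f) := by
  obtain ⟨v, hv⟩ := h.mem_opPow_domain.1 f.2
  have hc : Commute (S ^ γ) T := CFC.rpow_eq_cfc_real h.nonneg ▸ hT.cfc_real _
  have hc' : Commute ((1 - S) ^ γ) T :=
    one_sub_rpow_eq_cfc h.nonneg h.le_one hγ ▸ hT.cfc_real _
  rw [h.opPow_apply hγ f hv, h.opPow_apply hγ (v := T v)]
  · exact DFunLike.congr_fun hc'.eq v
  · exact (DFunLike.congr_fun hc.eq v).trans (congrArg T hv)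

/-- The operators 1 - S and (1 - S)^γ have the same kernel. This is what locates the ranges of the
powers relative to p₀. -/
lemma map_opPow_eq_zero {γ : ℝ} (hγ : 0 < γ) {T : H →L[ℂ] H} (hT : Commute S T)
    (hz : (1 - S) * T = 0) (f : (opPow X γ).domain) : T (opPow X γ f) = 0 := by
  obtain ⟨v, hv⟩ := h.mem_opPow_domain.1 f.2
  have hc' : Commute ((1 - S) ^ γ) T :=
    one_sub_rpow_eq_cfc h.nonneg h.le_one hγ ▸ hT.cfc_real _
  rw [h.opPow_apply hγ f hv]
  refine (DFunLike.congr_fun hc'.eq v).symm.trans ?_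
  refine rpow_apply_eq_zero (sub_nonneg.2 h.le_one) one_pos hγ ?_
  rw [CFC.rpow_one _ (sub_nonneg.2 h.le_one)]
  exact DFunLike.congr_fun hz v

/-- With t = (1 - r)/r the hypothesis says t ≤ 1, so X^δ is a continuous function of S, hence
bounded. -/
lemma opPow_add_of_le_spectrum (hS : ∀ r ∈ spectrum ℝ S, 1 / 2 ≤ r) {γ δ : ℝ} (hγ : 0 < γ)
    (hδ : 0 < δ) {f : H} (hf : f ∈ (opPow X (γ + δ)).domain) (hf' : f ∈ (opPow X γ).domain) :
    opPow X (γ + δ) ⟨f, hf⟩ = cfc (fun r : ℝ => ((1 - r) / r) ^ δ) S (opPow X γ ⟨f, hf'⟩) := by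
  obtain ⟨v, hv⟩ := h.mem_opPow_domain.1 hf
  have hv' : (S ^ γ) ((S ^ δ) v) = f := by rw [rpow_add_apply h.nonneg hγ hδ, hv]
  rw [h.opPow_apply (add_pos hγ hδ) ⟨f, hf⟩ hv, h.opPow_apply hγ ⟨f, hf'⟩ hv',
    one_sub_rpow_eq_cfc h.nonneg h.le_one hγ,
    one_sub_rpow_eq_cfc h.nonneg h.le_one (add_pos hγ hδ), CFC.rpow_eq_cfc_real h.nonneg]
  have c1 : ContinuousOn (fun r : ℝ => (1 - r) ^ γ) (spectrum ℝ S) :=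
    ((continuous_const.sub continuous_id).rpow_const fun _ => Or.inr hγ.le).continuousOn
  have c2 : ContinuousOn (fun r : ℝ => r ^ δ) (spectrum ℝ S) :=
    (continuous_id.rpow_const fun _ => Or.inr hδ.le).continuousOn
  have c3 : ContinuousOn (fun r : ℝ => ((1 - r) / r) ^ δ) (spectrum ℝ S) := by
    refine ContinuousOn.rpow_const (ContinuousOn.div (by fun_prop) (by fun_prop) fun r hr => ?_)
      fun _ _ => Or.inr hδ.le
    linarith [hS r hr]
  rw [cfc_mul_apply c1 c2 fun _ _ => rfl]
  refine (cfc_mul_apply c3 (c1.mul c2) (fun r hr => ?_) v).symm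
  have hr0 : 0 < r := by linarith [hS r hr]
  have hr1 : 0 ≤ 1 - r := sub_nonneg.2 (h.spectrum_le_one hr)
  have hrδ : r ^ δ ≠ 0 := (Real.rpow_pos_of_pos hr0 δ).ne'
  rw [Pi.mul_apply, Real.div_rpow hr1 hr0.le, Real.rpow_add_of_nonneg hr1 hγ.le hδ.le]
  field_simp

/-- The multiplier is t^(-δ) = (r/(1 - r))^δ where r ≤ 1/2. The point r = 1 is the kernel of X:
there the maximum prevents division by zero, and both sides vanish. -/
lemma opPow_eq_cfc_apply_opPow_add (hS : ∀ r ∈ spectrum ℝ S, r ≤ 1 / 2 ∨ r = 1) {γ δ : ℝ}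
    (hγ : 0 < γ) (hδ : 0 < δ) {f : H} (hf : f ∈ (opPow X (γ + δ)).domain)
    (hf' : f ∈ (opPow X γ).domain) : opPow X γ ⟨f, hf'⟩ =
      cfc (fun r : ℝ => (r / max (1 - r) (1 / 2)) ^ δ) S (opPow X (γ + δ) ⟨f, hf⟩) := by
  obtain ⟨v, hv⟩ := h.mem_opPow_domain.1 hf
  have hv' : (S ^ γ) ((S ^ δ) v) = f := by rw [rpow_add_apply h.nonneg hγ hδ, hv]
  rw [h.opPow_apply (add_pos hγ hδ) ⟨f, hf⟩ hv, h.opPow_apply hγ ⟨f, hf'⟩ hv',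
    one_sub_rpow_eq_cfc h.nonneg h.le_one hγ,
    one_sub_rpow_eq_cfc h.nonneg h.le_one (add_pos hγ hδ), CFC.rpow_eq_cfc_real h.nonneg]
  have c1 {γ : ℝ} (hγ : 0 < γ) : ContinuousOn (fun r : ℝ => (1 - r) ^ γ) (spectrum ℝ S) :=
    ((continuous_const.sub continuous_id).rpow_const fun _ => Or.inr hγ.le).continuousOn
  have c2 : ContinuousOn (fun r : ℝ => r ^ δ) (spectrum ℝ S) :=
    (continuous_id.rpow_const fun _ => Or.inr hδ.le).continuousOn
  have hpos (r : ℝ) : 0 < max (1 - r) (1 / 2) := lt_max_of_lt_right one_half_pos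
  have c3 : ContinuousOn (fun r : ℝ => (r / max (1 - r) (1 / 2)) ^ δ) (spectrum ℝ S) :=
    ContinuousOn.rpow_const (ContinuousOn.div (by fun_prop) (by fun_prop) fun r _ => (hpos r).ne')
      fun _ _ => Or.inr hδ.le
  rw [cfc_mul_apply (c1 hγ) c2 fun _ _ => rfl]
  refine (cfc_mul_apply c3 (c1 (add_pos hγ hδ)) (fun r hr => ?_) v).symm
  have hr0 : 0 ≤ r := spectrum_nonneg_of_nonneg h.nonneg hr
  rcases hS r hr with hr1 | rfl
  · have hr2 : 0 < 1 - r := by linarith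
    have hrδ : (1 - r) ^ δ ≠ 0 := (Real.rpow_pos_of_pos hr2 δ).ne'
    rw [max_eq_left (by linarith), Real.div_rpow hr0 hr2.le, Real.rpow_add hr2]
    field_simp
  · simp [Real.zero_rpow hγ.ne', Real.zero_rpow (add_pos hγ hδ).ne']

end IsPositiveResolvent

/-! ### The two parts of a positive operator -/

lemma IsPositiveResolvent.mulRight {X : H →ₗ.[ℂ] H} {S p : H →L[ℂ] H}
    (h : IsPositiveResolvent X S) (hp : IsStarProjection p) (hc : Commute S p) :
    IsPositiveResolvent (PowerLimit.mulRight X p) (S * p + (1 - p)) := by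
  have hpp : p * p = p := hp.isIdempotentElem
  refine ⟨h.toIsResolvent.mulRight hpp hc, ?_, ?_⟩
  · have h1 := hp.isSelfAdjoint.conjugate_nonneg h.nonneg
    rw [← hc.eq, mul_assoc, hpp] at h1
    exact add_nonneg h1 hp.one_sub.nonneg
  · have h1 := hp.isSelfAdjoint.conjugate_nonneg (sub_nonneg.2 h.le_one)
    rw [mul_sub, mul_one, sub_mul, hpp, ← hc.eq, mul_assoc, hpp] at h1
    rw [← sub_nonneg]
    convert! h1 using 1
    abel

end Powers

/-! ### The spectra of the resolvents of a₀ and a_∞ -/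

section Parts

variable {H : Type*} [NormedAddCommGroup H] [InnerProductSpace ℂ H] [CompleteSpace H]

lemma isStarProjection_projLow (a : H →ₗ.[ℂ] H) : IsStarProjection (projLow a) :=
  isStarProjection_starProjection

lemma projLow_mem {N : VonNeumannAlgebra H} {a : H →ₗ.[ℂ] H} (hR : resolvent a ∈ N) :
    projLow a ∈ N :=
  starProjection_ker_mem N (cfc_mem N hR _)

lemma cutoff_mul_projLow (a : H →ₗ.[ℂ] H) : cutoff a * projLow a = 0 := by
  ext v
  exact Submodule.starProjection_apply_mem (LinearMap.ker (cutoff a : H →ₗ[ℂ] H)) v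

lemma projLow_mul_of_cutoff_mul_eq_zero {a : H →ₗ.[ℂ] H} {T : H →L[ℂ] H}
    (hT : cutoff a * T = 0) : projLow a * T = T := by
  ext v
  exact Submodule.starProjection_eq_self_iff.2 (DFunLike.congr_fun hT v)

variable {a : H →ₗ.[ℂ] H} (ha : IsPositiveSelfAdjoint a)
  (hc : Commute (resolvent a) (projLow a))
include ha

lemma IsPositiveSelfAdjoint.isPositiveResolvent : IsPositiveResolvent a (resolvent a) :=
  ⟨ha.isResolvent, ha.resolvent_nonneg, ha.resolvent_le_one⟩

include hc

lemma isPositiveResolvent_lowPart : IsPositiveResolvent (lowPart a)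
    (resolvent a * projLow a + (1 - projLow a)) :=
  ha.isPositiveResolvent.mulRight (isStarProjection_projLow a) hc

lemma isPositiveResolvent_highPart : IsPositiveResolvent (highPart a)
    (resolvent a * (1 - projLow a) + (1 - (1 - projLow a))) :=
  ha.isPositiveResolvent.mulRight (isStarProjection_projLow a).one_sub
    ((Commute.one_right _).sub_right hc)

/-- Always R + (1/2 - R)₊ ≥ 1/2. Compression by p₀ removes the cutoff (1/2 - R)₊, and adding (1 -
p₀)/2 to the result gives S - 1/2 ≥ 0. -/
lemma le_spectrum_lowPart {r : ℝ}
    (hr : r ∈ spectrum ℝ (resolvent a * projLow a + (1 - projLow a))) : 1 / 2 ≤ r := by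
  have hS := (isPositiveResolvent_lowPart ha hc).nonneg
  have hR : IsSelfAdjoint (resolvent a) := .of_nonneg ha.resolvent_nonneg
  have hp := isStarProjection_projLow a
  have hpp : projLow a * projLow a = projLow a := hp.isIdempotentElem
  have hCp := cutoff_mul_projLow a
  have h1 : 0 ≤ resolvent a + cutoff a - algebraMap ℝ _ (1 / 2) := by
    have : resolvent a + cutoff a - algebraMap ℝ _ (1 / 2) =
        cfc (fun r : ℝ => r + max (1 / 2 - r) 0 - 1 / 2) (resolvent a) := by
      rw [cfc_sub (fun r : ℝ => r + max (1 / 2 - r) 0) (fun _ => 1 / 2) (resolvent a),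
        cfc_add (resolvent a) (fun r : ℝ => r) (fun r : ℝ => max (1 / 2 - r) 0), cfc_id' ℝ _,
        cfc_const (1 / 2) (resolvent a), cutoff]
    rw [this]
    refine cfc_nonneg fun r _ => ?_
    have := le_max_left (1 / 2 - r) 0
    linarith
  set R := resolvent a
  set p := projLow a
  set C := cutoff a
  set S := R * p + (1 - p) with hSdef
  have h2 : 0 ≤ S - algebraMap ℝ (H →L[ℂ] H) (1 / 2) := by
    have h3 := hp.isSelfAdjoint.conjugate_nonneg h1
    have h4 : (0 : H →L[ℂ] H) ≤ (1 / 2 : ℝ) • (1 - p) :=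
      smul_nonneg (by norm_num) hp.one_sub.nonneg
    have h5 := add_nonneg h3 h4
    convert! h5 using 1
    rw [mul_assoc, sub_mul, add_mul, hCp, add_zero, mul_sub, ← mul_assoc p R, ← hc.eq, mul_assoc R,
      hpp, Algebra.algebraMap_eq_smul_one, smul_mul_assoc, one_mul, mul_smul_comm, hpp, smul_sub]
    rw [hSdef]
    abel_nf
    module
  have h3 : S - algebraMap ℝ (H →L[ℂ] H) (1 / 2) = cfc (fun r : ℝ => r - 1 / 2) S := by
    have hsa : IsSelfAdjoint S := .of_nonneg hS
    rw [cfc_sub (fun r : ℝ => r) (fun _ => 1 / 2) S, cfc_id' ℝ S, cfc_const (1 / 2) S]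
  rw [h3, cfc_nonneg_iff _ S (by fun_prop) (.of_nonneg hS)] at h2
  linarith [h2 r hr]

/-- It suffices that (1/2 - S)(1 - S) ≥ 0, as this product is negative exactly for 1/2 < r < 1. It
equals (1/2 - R)(1 - R) q with q = 1 - p₀, and multiplication by q removes the negative part `E`. -/
lemma spectrum_highPart {r : ℝ}
    (hr : r ∈ spectrum ℝ (resolvent a * (1 - projLow a) + (1 - (1 - projLow a)))) :
    r ≤ 1 / 2 ∨ r = 1 := by
  have hpr := isPositiveResolvent_highPart ha hc
  have hr1 := hpr.spectrum_le_one hr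
  have hR : IsSelfAdjoint (resolvent a) := .of_nonneg ha.resolvent_nonneg
  have hp := isStarProjection_projLow a
  have hq := hp.one_sub
  have hqq : (1 - projLow a) * (1 - projLow a) = 1 - projLow a := hq.isIdempotentElem
  have hRq : Commute (resolvent a) (1 - projLow a) := (Commute.one_right _).sub_right hc
  -- The functions (1/2 - r)₊ and (r - 1/2)₊ have product zero, so the range of this operator lies
  -- in the kernel of the cutoff, that is, in ran p₀.
  have hpE := projLow_mul_of_cutoff_mul_eq_zero (a := a)
    (T := cfc (fun r : ℝ => max (r - 1 / 2) 0 * (1 - r)) (resolvent a)) (by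
      rw [cutoff, ← cfc_mul _ _ _ (by fun_prop) (by fun_prop)]
      rw [← cfc_zero ℝ (resolvent a)]
      refine cfc_congr fun r _ => ?_
      rcases le_total r (1 / 2) with h | h
      · simp only [max_eq_right (sub_nonpos.2 h), mul_zero, zero_mul, Pi.zero_apply]
      · simp only [max_eq_right (sub_nonpos.2 h), zero_mul, Pi.zero_apply])
  have hEq : Commute (cfc (fun r : ℝ => max (r - 1 / 2) 0 * (1 - r)) (resolvent a)) (projLow a) :=
    hc.cfc_real _
  have hCq : Commute (cfc (fun r : ℝ => max (1 / 2 - r) 0 * (1 - r)) (resolvent a))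
    (1 - projLow a) := hRq.cfc_real _
  have hC0 : 0 ≤ cfc (fun r : ℝ => max (1 / 2 - r) 0 * (1 - r)) (resolvent a) :=
    cfc_nonneg fun r hr => mul_nonneg (le_max_right _ _)
      (sub_nonneg.2 (ha.isPositiveResolvent.spectrum_le_one hr))
  have hdiff : (algebraMap ℝ _ (1 / 2) - resolvent a) * (1 - resolvent a) =
      cfc (fun r : ℝ => max (1 / 2 - r) 0 * (1 - r)) (resolvent a) -
        cfc (fun r : ℝ => max (r - 1 / 2) 0 * (1 - r)) (resolvent a) := by
    rw [← cfc_sub _ _ _ (by fun_prop) (by fun_prop)]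
    have h1 : algebraMap ℝ _ (1 / 2) - resolvent a =
        cfc (fun r : ℝ => 1 / 2 - r) (resolvent a) := by
      rw [cfc_sub (fun _ => 1 / 2) (fun r : ℝ => r) (resolvent a), cfc_id' ℝ _,
        cfc_const (1 / 2) (resolvent a)]
    have h2 : 1 - resolvent a = cfc (fun r : ℝ => 1 - r) (resolvent a) := by
      rw [cfc_sub (fun _ => 1) (fun r : ℝ => r) (resolvent a), cfc_id' ℝ _,
        cfc_const_one ℝ (resolvent a)]
    rw [h1, h2, ← cfc_mul _ _ _ (by fun_prop) (by fun_prop)]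
    refine cfc_congr fun r _ => ?_
    rcases le_total r (1 / 2) with h | h
    · simp only [max_eq_right (sub_nonpos.2 h), max_eq_left (sub_nonneg.2 h)]
      ring
    · simp only [max_eq_right (sub_nonpos.2 h), max_eq_left (sub_nonneg.2 h)]
      ring
  set R := resolvent a
  set E := cfc (fun r : ℝ => max (r - 1 / 2) 0 * (1 - r)) R
  set C := cfc (fun r : ℝ => max (1 / 2 - r) 0 * (1 - r)) R
  have hEq0 : E * (1 - projLow a) = 0 := by rw [mul_sub, mul_one, hEq.eq, hpE, sub_self]
  set q := 1 - projLow a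
  set S := R * q + (1 - q) with hSdef
  have hW : 1 - S = (1 - R) * q := by
    rw [hSdef, sub_mul, one_mul]
    abel
  have hW' : (1 - R) * q = q * (1 - R) := ((Commute.one_left q).sub_left hRq).eq
  have hSq : S * q = R * q := by
    rw [hSdef, add_mul, mul_assoc, hqq, sub_mul, one_mul, hqq, sub_self, add_zero]
  have hpos : 0 ≤ (algebraMap ℝ _ (1 / 2) - S) * (1 - S) := by
    have h1 := hq.isSelfAdjoint.conjugate_nonneg hC0
    rw [← hCq.eq, mul_assoc, hqq] at h1
    convert! h1 using 1
    rw [hW, sub_mul, hW', ← mul_assoc S, hSq, mul_assoc R, ← hW', ← sub_mul, ← mul_assoc, hdiff,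
      sub_mul, hEq0, sub_zero]
  have hsa : IsSelfAdjoint S := .of_nonneg hpr.nonneg
  have hcfc : (algebraMap ℝ _ (1 / 2) - S) * (1 - S) =
      cfc (fun r : ℝ => (1 / 2 - r) * (1 - r)) S := by
    rw [cfc_mul _ _ S (by fun_prop) (by fun_prop), cfc_sub (fun _ => 1 / 2) (fun r : ℝ => r) S,
      cfc_sub (fun _ => 1) (fun r : ℝ => r) S, cfc_id' ℝ _, cfc_const (1 / 2) S,
      cfc_const_one ℝ S]
  rw [hcfc, cfc_nonneg_iff _ S (by fun_prop) hsa] at hpos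
  have := hpos r hr
  by_contra! hne
  have hlt : r < 1 := lt_of_le_of_ne hr1 hne.2
  nlinarith [hne.1]

end Parts

/-! ### Vanishing of the off-diagonal forms and the (LF)-structure of the diagonal -/

section Core

/-- The cofinal sequence of exponents `2, 3, 4, …`. -/
def expSeq (n : ℕ) : Set.Ioi (1 : ℝ) := ⟨n + 2, Set.mem_Ioi.2 (by
  linarith [n.cast_nonneg (α := ℝ)])⟩

lemma exists_le_expSeq (α : Set.Ioi (1 : ℝ)) : ∃ n, α ≤ expSeq n := by
  obtain ⟨n, hn⟩ := exists_nat_ge (α : ℝ)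
  exact ⟨n, show (α : ℝ) ≤ n + 2 by linarith⟩

variable {H : Type*} [NormedAddCommGroup H] [InnerProductSpace ℂ H] [CompleteSpace H]

attribute [local instance] TopSubspace.top

/-- The operator `a₀ ^ α` on the common domain of all powers. -/
def lowPow (a : H →ₗ.[ℂ] H) {α : ℝ} (hα : 0 < α) (f : core a) : H :=
  opPow (lowPart a) α (Submodule.inclusion (core_le_low a hα) f)

/-- The operator `a_∞ ^ α` on the common domain of all powers. -/
def highPow (a : H →ₗ.[ℂ] H) {α : ℝ} (hα : 0 < α) (f : core a) : H :=
  opPow (highPart a) α (Submodule.inclusion (core_le_high a hα) f)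

variable {M : VonNeumannAlgebra H} {a : H →ₗ.[ℂ] H} (ha : IsPositiveSelfAdjoint a)
  (haff : IsAffiliated a (center M))
include ha haff

lemma projLow_mem_center : projLow a ∈ center M := projLow_mem (resolvent_mem ha haff)

lemma commute_resolvent_projLow : Commute (resolvent a) (projLow a) :=
  commute_of_mem_center (resolvent_mem ha haff) (projLow_mem_center ha haff).1

lemma commute_lowRes : Commute (resolvent a * projLow a + (1 - projLow a)) (projLow a) :=
  ((commute_resolvent_projLow ha haff).mul_left (.refl _)).add_left
    ((Commute.one_left _).sub_left (.refl _))

lemma commute_highRes :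
    Commute (resolvent a * (1 - projLow a) + (1 - (1 - projLow a))) (projLow a) :=
  ((commute_resolvent_projLow ha haff).mul_left ((Commute.one_left _).sub_left (.refl _))).add_left
    ((Commute.one_left _).sub_left ((Commute.one_left _).sub_left (.refl _)))

lemma projLow_mem_core {f : H} (hf : f ∈ core a) : projLow a f ∈ core a := by
  have hc := commute_resolvent_projLow ha haff
  rw [core, Submodule.mem_iInf] at hf ⊢
  exact fun α => ⟨(isPositiveResolvent_lowPart ha hc).map_mem (commute_lowRes ha haff) (hf α).1,
    (isPositiveResolvent_highPart ha hc).map_mem (commute_highRes ha haff) (hf α).2⟩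

lemma projLow_lowPow {α : ℝ} (hα : 0 < α) (f : core a) :
    projLow a (lowPow a hα f) = lowPow a hα f := by
  have hpp : projLow a * projLow a = projLow a := (isStarProjection_projLow a).isIdempotentElem
  have h := (isPositiveResolvent_lowPart ha
    (commute_resolvent_projLow ha haff)).map_opPow_eq_zero hα (T := 1 - projLow a) ((Commute.one_right _).sub_right (commute_lowRes ha haff)) (by
      rw [← sub_sub, sub_right_comm, sub_sub_cancel, sub_mul, mul_assoc, mul_sub, mul_one, hpp,
        sub_self, mul_zero, sub_zero])
    (Submodule.inclusion (core_le_low a hα) f)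
  exact (sub_eq_zero.1 h).symm

lemma projLow_highPow {α : ℝ} (hα : 0 < α) (f : core a) :
    projLow a (highPow a hα f) = 0 := by
  have hpp : projLow a * projLow a = projLow a := (isStarProjection_projLow a).isIdempotentElem
  refine (isPositiveResolvent_highPart ha (commute_resolvent_projLow ha haff)).map_opPow_eq_zero hα
    (commute_highRes ha haff) ?_ (Submodule.inclusion (core_le_high a hα) f)
  rw [← sub_sub, sub_right_comm, sub_sub_cancel, sub_mul, mul_assoc, sub_mul, one_mul, hpp,
        sub_self, mul_zero, sub_zero]

lemma lowPow_projLow {α : ℝ} (hα : 0 < α) (f : core a) :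
    lowPow a hα ⟨projLow a f, projLow_mem_core ha haff f.2⟩ = lowPow a hα f :=
  ((isPositiveResolvent_lowPart ha (commute_resolvent_projLow ha haff)).opPow_map hα
    (commute_lowRes ha haff) (Submodule.inclusion (core_le_low a hα) f)).trans
    (projLow_lowPow ha haff hα f)

lemma highPow_projLow {α : ℝ} (hα : 0 < α) (f : core a) :
    highPow a hα ⟨projLow a f, projLow_mem_core ha haff f.2⟩ = 0 :=
  ((isPositiveResolvent_highPart ha (commute_resolvent_projLow ha haff)).opPow_map hα
    (commute_highRes ha haff) (Submodule.inclusion (core_le_high a hα) f)).trans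
    (projLow_highPow ha haff hα f)

/-- The multiplier is the bounded operator a₀^(β - α), a function of a resolvent in `M`. Equal
exponents are separate because the functional calculus identity needs a positive difference. -/
lemma exists_lowPow_eq {α β : ℝ} (hα : 0 < α) (hβ : 0 < β) (hαβ : α ≤ β) :
    ∃ c ∈ M, ∀ f, lowPow a hβ f = c (lowPow a hα f) := by
  rcases hαβ.eq_or_lt with rfl | hlt
  · exact ⟨1, one_mem M, fun f => rfl⟩
  obtain ⟨δ, hδ, rfl⟩ : ∃ δ, 0 < δ ∧ β = α + δ := ⟨β - α, sub_pos.2 hlt, by ring⟩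
  have hc := commute_resolvent_projLow ha haff
  have hR := (resolvent_mem ha haff).1
  have hp := (projLow_mem_center ha haff).1
  have hS : resolvent a * projLow a + (1 - projLow a) ∈ M :=
    add_mem (S := VonNeumannAlgebra H) (mul_mem (S := VonNeumannAlgebra H) hR hp)
      (sub_mem (S := VonNeumannAlgebra H) (one_mem M) hp)
  exact ⟨_, cfc_mem M hS _, fun f => (isPositiveResolvent_lowPart ha hc).opPow_add_of_le_spectrum
    (fun r hr => le_spectrum_lowPart ha hc hr) hα hδ _ _⟩

lemma exists_highPow_eq {α β : ℝ} (hα : 0 < α) (hβ : 0 < β) (hαβ : α ≤ β) :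
    ∃ c ∈ M, ∀ f, highPow a hα f = c (highPow a hβ f) := by
  rcases hαβ.eq_or_lt with rfl | hlt
  · exact ⟨1, one_mem M, fun f => rfl⟩
  obtain ⟨δ, hδ, rfl⟩ : ∃ δ, 0 < δ ∧ β = α + δ := ⟨β - α, sub_pos.2 hlt, by ring⟩
  have hc := commute_resolvent_projLow ha haff
  have hR := (resolvent_mem ha haff).1
  have hq : 1 - projLow a ∈ M :=
    sub_mem (S := VonNeumannAlgebra H) (one_mem M) (projLow_mem_center ha haff).1
  have hS : resolvent a * (1 - projLow a) + (1 - (1 - projLow a)) ∈ M :=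
    add_mem (S := VonNeumannAlgebra H) (mul_mem (S := VonNeumannAlgebra H) hR hq)
      (sub_mem (S := VonNeumannAlgebra H) (one_mem M) hq)
  exact ⟨_, cfc_mem M hS _, fun f =>
    (isPositiveResolvent_highPart ha hc).opPow_eq_cfc_apply_opPow_add
      (fun r hr => spectrum_highPart ha hc hr) hα hδ _ _⟩

/-! ### The spaces of forms of the powers -/

lemma LinfLow_anti {α β : Set.Ioi (1 : ℝ)} (h : α ≤ β) : LinfLow M a β ≤ LinfLow M a α := by
  have hα : (0 : ℝ) < α / 2 := half_pos (one_pos.trans α.2)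
  have hβ : (0 : ℝ) < β / 2 := half_pos (one_pos.trans β.2)
  obtain ⟨c, hc, hcf⟩ := exists_lowPow_eq ha haff hα hβ (div_le_div_of_nonneg_right h two_pos.le)
  exact formSpace_le M hc hc hcf hcf

lemma LinfHigh_mono {α β : Set.Ioi (1 : ℝ)} (h : α ≤ β) : LinfHigh M a α ≤ LinfHigh M a β := by
  have hα : (0 : ℝ) < α / 2 := half_pos (one_pos.trans α.2)
  have hβ : (0 : ℝ) < β / 2 := half_pos (one_pos.trans β.2)
  obtain ⟨c, hc, hcf⟩ := exists_highPow_eq ha haff hα hβ (div_le_div_of_nonneg_right h two_pos.le)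
  exact formSpace_le M hc hc hcf hcf

lemma inner_projLow_comm {x : H →L[ℂ] H} (hx : x ∈ M) (u v : H) :
    inner ℂ (projLow a u) (x v) = inner ℂ u (x (projLow a v)) := by
  have h := (isStarProjection_projLow a).isSelfAdjoint.isSymmetric u (x v)
  have h2 := commute_of_mem_center (projLow_mem_center ha haff) hx
  exact h.trans (congrArg _ (DFunLike.congr_fun h2.eq v))

/-- The projection p₀ fixes a₀^α g, passes through x by centrality, and kills a_∞^β f. -/
lemma carrier_offLowHigh (α β : Set.Ioi (0 : ℝ)) : (offLowHigh M a α β).carrier = ⊥ := by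
  rw [eq_bot_iff]
  rintro _ ⟨x, hx, rfl⟩
  rw [Submodule.mem_bot]
  ext f g
  have hα : (0 : ℝ) < α := α.2
  have hβ : (0 : ℝ) < β := β.2
  change inner ℂ (lowPow a hα g) (x (highPow a hβ f)) = 0
  rw [← projLow_lowPow ha haff, inner_projLow_comm ha haff hx, projLow_highPow ha haff, map_zero,
    inner_zero_right]

lemma carrier_offHighLow (α β : Set.Ioi (0 : ℝ)) : (offHighLow M a α β).carrier = ⊥ := by
  rw [eq_bot_iff]
  rintro _ ⟨x, hx, rfl⟩
  rw [Submodule.mem_bot]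
  ext f g
  have hα : (0 : ℝ) < α := α.2
  have hβ : (0 : ℝ) < β := β.2
  change inner ℂ (highPow a hβ g) (x (lowPow a hα f)) = 0
  rw [← projLow_lowPow ha haff, ← inner_projLow_comm ha haff hx, projLow_highPow ha haff,
    inner_zero_left]

lemma LinfLow_apply_projLow (α : Set.Ioi (1 : ℝ)) {y : Form (core a)}
    (hy : y ∈ (LinfLow M a α).carrier) (f g : core a) :
    y ⟨projLow a f, projLow_mem_core ha haff f.2⟩ ⟨projLow a g, projLow_mem_core ha haff g.2⟩ =
      y f g := by
  have hα : (0 : ℝ) < α / 2 := half_pos (one_pos.trans α.2)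
  obtain ⟨x, -, rfl⟩ := hy
  change inner ℂ (lowPow a hα _) (x (lowPow a hα _)) = inner ℂ (lowPow a hα _) (x (lowPow a hα _))
  rw [lowPow_projLow ha haff, lowPow_projLow ha haff]

lemma limHigh_apply_projLow {y : Form (core a)} (hy : y ∈ (limHigh M a).carrier) (f g : core a) :
    y ⟨projLow a f, projLow_mem_core ha haff f.2⟩ ⟨projLow a g, projLow_mem_core ha haff g.2⟩ =
      0 := by
  have h : (limHigh M a).carrier ≤ (evalForm ⟨projLow a f, projLow_mem_core ha haff f.2⟩
      ⟨projLow a g, projLow_mem_core ha haff g.2⟩).ker := by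
    refine iSup_le fun α => ?_
    have hα : (0 : ℝ) < α / 2 := half_pos (one_pos.trans α.2)
    rintro _ ⟨x, -, rfl⟩
    change inner ℂ (highPow a hα _) (x (highPow a hα _)) = 0
    rw [highPow_projLow ha haff, inner_zero_left]
  exact h hy

/-- Replacing (f, g) by (p₀ f, p₀ g) leaves low forms unchanged and annihilates high forms, so a
form of both kinds is zero. -/
lemma sumMap_limits_injective {B C : TopSubspace (Form (core a))} (hB : B.carrier = ⊥)
    (hC : C.carrier = ⊥) : Function.Injective (sumMap (limLow M a) B C (limHigh M a)) := by
  refine (injective_iff_map_eq_zero _).2 ?_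
  rintro ⟨⟨x, b⟩, ⟨c, z⟩⟩ h
  have hb : (b : Form (core a)) = 0 := (Submodule.mem_bot ℂ).1 (hB ▸ b.2)
  have hc : (c : Form (core a)) = 0 := (Submodule.mem_bot ℂ).1 (hC ▸ c.2)
  rw [sumMap_apply, hb, hc, add_zero, zero_add] at h
  have hx : (x : Form (core a)) = 0 := by
    ext f g
    -- Any exponent above 1 would do.
    have hx' : (x : Form (core a)) ∈ (LinfLow M a ⟨2, Set.mem_Ioi.2 one_lt_two⟩).carrier :=
      (Submodule.mem_iInf _).1 x.2 _
    rw [← LinfLow_apply_projLow ha haff _ hx', eq_neg_of_add_eq_zero_left h, LinearMap.neg_apply,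
      LinearMap.neg_apply, limHigh_apply_projLow ha haff z.2, neg_zero]
    rfl
  rw [hx, zero_add] at h
  exact Prod.ext (Prod.ext (Subtype.ext hx) (Subtype.ext hb))
    (Prod.ext (Subtype.ext hc) (Subtype.ext h))

lemma isFrechet_limLow : (limLow M a).IsFrechet := by
  rw [limLow, projLim_eq_of_cofinal expSeq fun α => (exists_le_expSeq α).imp fun _ hn =>
    LinfLow_anti ha haff hn]
  exact isFrechet_projLim (fun n => isFrechet_formSpace ..) eq_zero_of_evaluations
    fun n => continuousFunctionals_formSpace _ _ _ _ _

lemma limHigh_eq : limHigh M a = indLim fun n => LinfHigh M a (expSeq n) :=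
  indLim_eq_of_cofinal expSeq fun α => (exists_le_expSeq α).imp fun _ hn =>
    LinfHigh_mono ha haff hn

/-- The defining sequence varies only the last entry of the matrix, along the exponents `expSeq n`.
-/
lemma isLFSpace_matrixSpace {B C : TopSubspace (Form (core a))} (hB : B.carrier = ⊥)
    (hC : C.carrier = ⊥) : IsLFSpace (matrixSpace (limLow M a) B C (limHigh M a)) := by
  have hinj := sumMap_limits_injective (M := M) ha haff hB hC
  have hA := isFrechet_limLow (M := M) ha haff
  have hB' := TopSubspace.isFrechet_of_eq_bot hB
  have hC' := TopSubspace.isFrechet_of_eq_bot hC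
  have hF (n : ℕ) : (matrixSpace (limLow M a) B C (LinfHigh M a (expSeq n))).IsFrechet :=
    isFrechet_matrixSpace (sumMap_injective_of_le hinj (le_indLim (LinfHigh M a) (expSeq n)).1)
      hA hB' hC' (isFrechet_formSpace ..)
  constructor
  · refine TopSubspace.ContinuousFunctionals.t2Space (Λ := evaluations (core a)) ?_
      eq_zero_of_evaluations
    have h0 {E : TopSubspace (Form (core a))} (hE : E.carrier = ⊥) :
        E.ContinuousFunctionals (evaluations (core a)) := fun l _ => by
      refine continuous_const (y := 0) |>.congr fun y => ?_
      rw [(Submodule.mem_bot ℂ).1 (hE ▸ y.2 : (y : Form (core a)) ∈ _), map_zero]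
    exact continuousFunctionals_matrixSpace
      (.of_le (projLim_le (LinfLow M a) (expSeq 0)) (continuousFunctionals_formSpace _ _ _ _ _))
      (h0 hB) (h0 hC) (continuousFunctionals_indLim fun _ =>
        continuousFunctionals_formSpace _ _ _ _ _)
  · refine ⟨fun n => matrixSpace (limLow M a) B C (LinfHigh M a (expSeq n)), hF, fun n => ?_, ?_⟩
    · refine matrixSpace_le (hF (n + 1)).1 le_matrixSpace₁₁ le_matrixSpace₁₂ le_matrixSpace₂₁
        ((LinfHigh_mono ha haff ?_).trans le_matrixSpace₂₂)
      change (n : ℝ) + 2 ≤ ((n + 1 : ℕ) : ℝ) + 2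
      push_cast
      linarith
    · rw [limHigh_eq ha haff]
      rw [limHigh_eq ha haff] at hinj
      exact matrixSpace_indLim hA.isLocallyConvex hB'.isLocallyConvex hC'.isLocallyConvex hinj

end Core

end PowerLimit

end

theorem mainTheorem4 {H : Type*} [NormedAddCommGroup H] [InnerProductSpace ℂ H] [CompleteSpace H]
    (M : VonNeumannAlgebra H) (a : H →ₗ.[ℂ] H) (ha : PowerLimit.IsPositiveSelfAdjoint a)
    (haff : PowerLimit.IsAffiliated a (PowerLimit.center M)) :
    PowerLimit.lowerOff (PowerLimit.offLowHigh M a) =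
        PowerLimit.upperOff (PowerLimit.offLowHigh M a) ∧
      PowerLimit.lowerOff (PowerLimit.offHighLow M a) =
        PowerLimit.upperOff (PowerLimit.offHighLow M a) ∧
      PowerLimit.lowerLim M a = PowerLimit.upperLim M a ∧
      PowerLimit.IsLFSpace (PowerLimit.upperLim M a) := by
  have h1 := PowerLimit.carrier_offLowHigh ha haff
  have h2 := PowerLimit.carrier_offHighLow ha haff
  -- A one-point space has only one topology, so equality of the carriers suffices.
  have e1 := PowerLimit.TopSubspace.ext_of_eq_bot (PowerLimit.carrier_lowerOff_eq_bot h1)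
    (PowerLimit.carrier_upperOff_eq_bot h1)
  have e2 := PowerLimit.TopSubspace.ext_of_eq_bot (PowerLimit.carrier_lowerOff_eq_bot h2)
    (PowerLimit.carrier_upperOff_eq_bot h2)
  refine ⟨e1, e2, ?_, ?_⟩
  · rw [PowerLimit.lowerLim, e1, e2, PowerLimit.upperLim]
  · exact PowerLimit.isLFSpace_matrixSpace ha haff (PowerLimit.carrier_upperOff_eq_bot h1)
      (PowerLimit.carrier_upperOff_eq_bot h2)
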